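/- **Setting.** Let $\Bbbk$ be a field, $H$ a Hopf algebra over $\Bbbk$ with bijective antipode, and $\mathcal C={}^H_H\mathcal{YD}$ the braided category of left Yetter-Drinfeld modules over $H$, with braiding $c_{V,W}(v\otimes w)=v_{(-1)}\cdot w\otimes v_{(0)}$. Let $\theta\in\mathbb N$ and let $\alpha_1,\dots,\alpha_\theta$ be the unit vectors of $\mathbb N_0^\theta$. A *pre-Nichols system* is a pair $(Q,(N_1,\dots,N_\theta))$ in which $Q=\bigoplus_{n\in\mathbb N_0^\theta}Q(n)$ is an $\mathbb N_0^\theta$-graded Hopf algebra in $\mathcal C$, the $N_j=Q(\alpha_j)$ are finite-dimensional subobjects of $Q$ in $\mathcal C$, and $Q$ is generated as an algebra by $N_1,\dots,N_\theta$. Fix a pre-Nichols system, an abelian group $\Gamma\supseteq\mathbb Z^\theta$, and view $Q$ as $\Gamma$-graded. Let $V=\bigoplus_{\gamma\in\Gamma}V(\gamma)$ be a $\Gamma$-graded Yetter-Drinfeld module over $Q$ in $\mathcal C$ (grading in $\mathcal C$, with graded $Q$-action and graded $Q$-coaction $\delta_V^Q$) that is generated as a $Q$-module by one homogeneous component $V_0=V(\gamma_0)$,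 and let $\pi_0:V\to V_0$ be the canonical projection. The *Shapovalov morphism* of $V$ is $$f_V=(\mathrm{id}_Q\otimes\pi_0)\,\delta_V^Q: V\to Q\otimes V_0 .$$ Fix $i\in\{1,\dots,\theta\}$. Assume that the subalgebra $\Bbbk[N_i]\subseteq Q$ generated by $N_i$, with grading $\Bbbk[N_i](n)=N_i^n$, is strictly graded (its degree $0$ part is one-dimensional and its primitive elements are exactly the elements of $N_i$), and that there is $\lambda_i\in\Bbbk\setminus\{0\}$ with $$c_{V_0,N_i}\,c_{N_i,V_0}=\lambda_i\,\mathrm{id}_{N_i\otimes V_0}.$$ **Shuffle elements.** Let $n\in\mathbb N_0$, and let $\mathbb B_{n+1}$ be the braid group with generators $c_1,\dots,c_n$. For $\pi\in\mathbb S_{n+1}$ let $c_\pi=c_{i_1}\cdots c_{i_l}\in\mathbb B_{n+1}$, where $\pi=s_{i_1}\cdots s_{i_l}$ is a reduced decomposition into adjacent transpositions. For $0\le k\le n$ put $$g_{n,k}=\sum_{\pi}c_{\pi^{-1}}\in\Bbbk\mathbb B_{n+1},$$ the sum over all $\pi\in\mathbb S_{n+1}$ with $\pi(1)<\dots<\pi(n-k)$,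 $\pi(n-k+1)=n+1$ and $\pi(n-k+2)>\dots>\pi(n+1)$; for $k>n$ put $g_{n,k}=0$. The algebra $\Bbbk\mathbb B_{n+1}$ acts on $N_i^{\otimes(n+1)}$, where $c_j$ acts as $\mathrm{id}^{\otimes(j-1)}\otimes c_{N_i,N_i}\otimes\mathrm{id}^{\otimes(n-j)}$. **Theorem.** For every $n\in\mathbb N_0$, the elements $g_{n,k}$ induce, through the multiplication map $N_i^{\otimes(n+1)}\to N_i^{n+1}\subseteq Q$, well-defined endomorphisms $g_{n,k}$ of $N_i^{n+1}$, and for all $x\in N_i^{n+1}$ and $v\in V_0$ $$f_V(x\cdot v)=(1-\lambda_i)\sum_{k=0}^{n}(-\lambda_i)^k\,g_{n,k}(x)\otimes v .$$ -/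

import Mathlib

open scoped TensorProduct

noncomputable section

namespace YDNichols

section Objects

variable {k : Type*} [Field k]

/-- For `c : A ⊗ B → B' ⊗ A'` the map
`id ⊗ c ⊗ id : (X ⊗ A) ⊗ (B ⊗ Y) → (X ⊗ B') ⊗ (A' ⊗ Y)`. -/
def middle {A B A' B' : Type*} (X Y : Type*)
    [AddCommGroup A] [Module k A] [AddCommGroup B] [Module k B]
    [AddCommGroup A'] [Module k A'] [AddCommGroup B'] [Module k B']
    [AddCommGroup X] [Module k X] [AddCommGroup Y] [Module k Y]
    (c : A ⊗[k] B →ₗ[k] B' ⊗[k] A') :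
    (X ⊗[k] A) ⊗[k] (B ⊗[k] Y) →ₗ[k] (X ⊗[k] B') ⊗[k] (A' ⊗[k] Y) :=
  (TensorProduct.assoc k X B' (A' ⊗[k] Y)).symm.toLinearMap ∘ₗ
    ((TensorProduct.assoc k B' A' Y).toLinearMap ∘ₗ c.rTensor Y ∘ₗ
      (TensorProduct.assoc k A B Y).symm.toLinearMap).lTensor X ∘ₗ
    (TensorProduct.assoc k X A (B ⊗[k] Y)).toLinearMap

/-- A pair of linear maps `R ⊗ V → V` and `V → R ⊗ V`; no laws yet. -/
structure ActCoact (k R V : Type*) [Field k] [AddCommGroup R] [Module k R]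
    [AddCommGroup V] [Module k V] where
  act : R ⊗[k] V →ₗ[k] V
  coact : V →ₗ[k] R ⊗[k] V

/-- `V` is a left `R`-module and a left `R`-comodule (no compatibility between the two). -/
structure ActCoact.IsModComod {R V : Type*} [Ring R] [Algebra k R] [Coalgebra k R]
    [AddCommGroup V] [Module k V] (X : ActCoact k R V) : Prop where
  one_act : ∀ v : V, X.act (1 ⊗ₜ v) = v
  mul_act : ∀ (a b : R) (v : V), X.act ((a * b) ⊗ₜ v) = X.act (a ⊗ₜ X.act (b ⊗ₜ v))
  counit_coact : (TensorProduct.lid k V).toLinearMap ∘ₗ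
    (Coalgebra.counit (R := k) (A := R)).rTensor V ∘ₗ X.coact = LinearMap.id
  coassoc : (TensorProduct.assoc k R R V).toLinearMap ∘ₗ
    (Coalgebra.comul (R := k) (A := R)).rTensor V ∘ₗ X.coact = X.coact.lTensor R ∘ₗ X.coact

/-- The Yetter-Drinfeld compatibility, relative to braidings `c_{R,R}`, `c_{R,V}`, `c_{V,R}`:
`(μ ⊗ ν)(id ⊗ c_{R,R} ⊗ id)(Δ ⊗ δ)
  = (μ ⊗ id)(id ⊗ c_{V,R})(δν ⊗ id)(id ⊗ c_{R,V})(Δ ⊗ id)`. -/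
def ActCoact.YDCompat {R V : Type*} [Ring R] [Algebra k R] [Coalgebra k R]
    [AddCommGroup V] [Module k V] (X : ActCoact k R V)
    (cRR : R ⊗[k] R →ₗ[k] R ⊗[k] R) (cRV : R ⊗[k] V →ₗ[k] V ⊗[k] R)
    (cVR : V ⊗[k] R →ₗ[k] R ⊗[k] V) : Prop :=
  TensorProduct.map (LinearMap.mul' k R) X.act ∘ₗ middle R V cRR ∘ₗ
      TensorProduct.map Coalgebra.comul X.coact =
    (LinearMap.mul' k R).rTensor V ∘ₗ
      (TensorProduct.assoc k R R V).symm.toLinearMap ∘ₗ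
      cVR.lTensor R ∘ₗ
      (TensorProduct.assoc k R V R).toLinearMap ∘ₗ
      (X.coact ∘ₗ X.act).rTensor R ∘ₗ
      (TensorProduct.assoc k R V R).symm.toLinearMap ∘ₗ
      cRV.lTensor R ∘ₗ
      (TensorProduct.assoc k R R V).toLinearMap ∘ₗ
      (Coalgebra.comul (R := k) (A := R)).rTensor V

end Objects

section YetterDrinfeld

variable {k H : Type*} [Field k] [Ring H] [HopfAlgebra k H]
variable {V W : Type*} [AddCommGroup V] [Module k V] [AddCommGroup W] [Module k W]

/-- `V` is a left Yetter-Drinfeld module over `H` in vector spaces (braiding: the flip), that is,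
an object of the category `𝒞` of left Yetter-Drinfeld modules over `H`. -/
structure ActCoact.IsYetterDrinfeld (X : ActCoact k H V) : Prop extends X.IsModComod where
  compat : X.YDCompat (TensorProduct.comm k H H).toLinearMap (TensorProduct.comm k H V).toLinearMap
    (TensorProduct.comm k V H).toLinearMap

/-- The braiding of `𝒞`: `c_{V,W} = (ν_W ⊗ id)(id ⊗ flip)(δ_V ⊗ id)`, i.e.
`v ⊗ w ↦ v₍₋₁₎ · w ⊗ v₍₀₎`. -/
def braiding (X : ActCoact k H V) (Y : ActCoact k H W) : V ⊗[k] W →ₗ[k] W ⊗[k] V :=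
  Y.act.rTensor V ∘ₗ
    (TensorProduct.assoc k H W V).symm.toLinearMap ∘ₗ
    (TensorProduct.comm k V W).toLinearMap.lTensor H ∘ₗ
    (TensorProduct.assoc k H V W).toLinearMap ∘ₗ
    X.coact.rTensor W

/-- The tensor product in `𝒞`: diagonal action and codiagonal coaction. -/
def ActCoact.tensor (X : ActCoact k H V) (Y : ActCoact k H W) : ActCoact k H (V ⊗[k] W) where
  act := TensorProduct.map X.act Y.act ∘ₗ middle H W (TensorProduct.comm k H V).toLinearMap ∘ₗ
    (Coalgebra.comul (R := k) (A := H)).rTensor (V ⊗[k] W)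
  coact := (LinearMap.mul' k H).rTensor (V ⊗[k] W) ∘ₗ
    middle H W (TensorProduct.comm k V H).toLinearMap ∘ₗ
    TensorProduct.map X.coact Y.coact

/-- The unit object of `𝒞`: the field with trivial action and coaction. -/
def unitObj (k H : Type*) [Field k] [Ring H] [HopfAlgebra k H] : ActCoact k H k where
  act := (TensorProduct.lid k k).toLinearMap ∘ₗ
    (Coalgebra.counit (R := k) (A := H)).rTensor k
  coact := TensorProduct.mk k H k 1

/-- Morphisms of `𝒞`: `H`-linear and `H`-colinear maps. -/
structure IsHom (X : ActCoact k H V) (Y : ActCoact k H W) (f : V →ₗ[k] W) : Prop where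
  map_act : f ∘ₗ X.act = Y.act ∘ₗ f.lTensor H
  map_coact : Y.coact ∘ₗ f = f.lTensor H ∘ₗ X.coact

/-- `N ⊆ V` is a subobject in `𝒞`. -/
structure ActCoact.IsSub (X : ActCoact k H V) (N : Submodule k V) : Prop where
  act_mem : ∀ (h : H), ∀ v ∈ N, X.act (h ⊗ₜ v) ∈ N
  coact_mem : ∀ v ∈ N, X.coact v ∈ LinearMap.range (N.subtype.lTensor H)

theorem ActCoact.IsSub.act_mem_tensor {X : ActCoact k H V} {N : Submodule k V} (h : X.IsSub N)
    (t : H ⊗[k] N) : (X.act ∘ₗ N.subtype.lTensor H) t ∈ N := by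
  induction t using TensorProduct.induction_on with
  | zero => simp
  | tmul a b => simpa using h.act_mem a b b.2
  | add a b ha hb => rw [map_add]; exact N.add_mem ha hb

theorem lTensor_subtype_injective (N : Submodule k V) :
    Function.Injective (N.subtype.lTensor H) :=
  Module.Flat.lTensor_preserves_injective_linearMap _ N.injective_subtype

/-- The restricted action and coaction on a subobject. -/
def ActCoact.sub (X : ActCoact k H V) (N : Submodule k V) (h : X.IsSub N) : ActCoact k H N where
  act := (X.act ∘ₗ N.subtype.lTensor H).codRestrict N h.act_mem_tensor
  coact :=
    (LinearEquiv.ofInjective (N.subtype.lTensor H) (lTensor_subtype_injective N)).symm.toLinearMap ∘ₗ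
      (X.coact ∘ₗ N.subtype).codRestrict (LinearMap.range (N.subtype.lTensor H))
        (fun v => h.coact_mem v v.2)

variable {Q : Type*} [Ring Q] [Algebra k Q] [Coalgebra k Q]

/-- `Q` (with its algebra and coalgebra structure) is a Hopf algebra in `𝒞` with antipode `S`. -/
structure IsBraidedHopfAlgebra (X : ActCoact k H Q) (S : Q →ₗ[k] Q) : Prop where
  isYetterDrinfeld : X.IsYetterDrinfeld
  unit_hom : IsHom (unitObj k H) X (Algebra.linearMap k Q)
  mul_hom : IsHom (X.tensor X) X (LinearMap.mul' k Q)
  counit_hom : IsHom X (unitObj k H) Coalgebra.counit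
  comul_hom : IsHom X (X.tensor X) Coalgebra.comul
  counit_one : Coalgebra.counit (R := k) (1 : Q) = 1
  counit_mul : ∀ a b : Q,
    Coalgebra.counit (R := k) (a * b) = Coalgebra.counit (R := k) a * Coalgebra.counit (R := k) b
  comul_one : Coalgebra.comul (R := k) (1 : Q) = 1 ⊗ₜ 1
  comul_mul : (Coalgebra.comul (R := k) (A := Q)) ∘ₗ LinearMap.mul' k Q =
    TensorProduct.map (LinearMap.mul' k Q) (LinearMap.mul' k Q) ∘ₗ
      middle Q Q (braiding X X) ∘ₗ
      TensorProduct.map Coalgebra.comul Coalgebra.comul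
  antipode_hom : IsHom X X S
  mul_antipode_left : LinearMap.mul' k Q ∘ₗ S.rTensor Q ∘ₗ Coalgebra.comul =
    Algebra.linearMap k Q ∘ₗ Coalgebra.counit
  mul_antipode_right : LinearMap.mul' k Q ∘ₗ S.lTensor Q ∘ₗ Coalgebra.comul =
    Algebra.linearMap k Q ∘ₗ Coalgebra.counit

/-- `V ∈ 𝒞` (via `XV`) is, via `Y`, a left Yetter-Drinfeld module over `Q` in `𝒞`. -/
structure IsYetterDrinfeldOver (XQ : ActCoact k H Q) (XV : ActCoact k H V)
    (Y : ActCoact k Q V) : Prop where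
  isYetterDrinfeld : XV.IsYetterDrinfeld
  isModComod : Y.IsModComod
  act_hom : IsHom (XQ.tensor XV) XV Y.act
  coact_hom : IsHom XV (XQ.tensor XV) Y.coact
  compat : Y.YDCompat (braiding XQ XQ) (braiding XQ XV) (braiding XV XQ)

/-- The image of `A ⊗ B` in `Q ⊗ V`. -/
def tensorSub (A : Submodule k Q) (B : Submodule k V) : Submodule k (Q ⊗[k] V) :=
  LinearMap.range (TensorProduct.map A.subtype B.subtype)

end YetterDrinfeld

section Nichols

/-- A pre-Nichols system `(Q, (N_1, …, N_θ))` in the category `𝒞` of Yetter-Drinfeld modules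
over `H`. -/
structure PreNicholsSystem (k H Q : Type*) [Field k] [Ring H] [HopfAlgebra k H]
    [Ring Q] [Algebra k Q] [Coalgebra k Q] (θ : ℕ) where
  obj : ActCoact k H Q
  antipode : Q →ₗ[k] Q
  isBraidedHopf : IsBraidedHopfAlgebra obj antipode
  N : Fin θ → Submodule k Q
  finite : ∀ i, Module.Finite k (N i)
  adjoin_eq_top : Algebra.adjoin k (⋃ i, (N i : Set Q)) = ⊤
  /-- The homogeneous components `Q(n)`, `n ∈ ℕ₀^θ`. -/
  deg : (Fin θ → ℕ) → Submodule k Q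
  isInternal : DirectSum.IsInternal deg
  deg_isSub : ∀ n, obj.IsSub (deg n)
  one_mem : 1 ∈ deg 0
  mul_mem : ∀ m n, ∀ a ∈ deg m, ∀ b ∈ deg n, a * b ∈ deg (m + n)
  counit_eq_zero : ∀ n, n ≠ 0 → ∀ a ∈ deg n, Coalgebra.counit (R := k) a = 0
  comul_mem : ∀ n, ∀ a ∈ deg n, Coalgebra.comul (R := k) a ∈
    ⨆ (p : (Fin θ → ℕ) × (Fin θ → ℕ)) (_ : p.1 + p.2 = n), tensorSub (deg p.1) (deg p.2)
  antipode_mem : ∀ n, ∀ a ∈ deg n, antipode a ∈ deg n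
  deg_single : ∀ i, deg (Pi.single i 1) = N i

variable {k H Q : Type*} [Field k] [Ring H] [HopfAlgebra k H]
  [Ring Q] [Algebra k Q] [Coalgebra k Q] {θ : ℕ}

theorem PreNicholsSystem.N_isSub (𝒩 : PreNicholsSystem k H Q θ) (i : Fin θ) :
    𝒩.obj.IsSub (𝒩.N i) :=
  𝒩.deg_single i ▸ 𝒩.deg_isSub (Pi.single i 1)

/-- `N_i` as an object of `𝒞`. -/
def PreNicholsSystem.NObj (𝒩 : PreNicholsSystem k H Q θ) (i : Fin θ) : ActCoact k H (𝒩.N i) :=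
  𝒩.obj.sub (𝒩.N i) (𝒩.N_isSub i)

/-- The subalgebra `𝕜[N_i]` generated by `N_i`, graded by `𝕜[N_i](n) = N_i^n`, is strictly graded:
its component of degree `0` is one-dimensional and its primitive elements are exactly the elements
of degree `1`. -/
def PreNicholsSystem.StrictlyGraded (𝒩 : PreNicholsSystem k H Q θ) (i : Fin θ) : Prop :=
  Module.finrank k ↥(𝒩.N i ^ 0) = 1 ∧
  ∀ a ∈ Algebra.adjoin k (𝒩.N i : Set Q),
    (Coalgebra.comul (R := k) a = a ⊗ₜ[k] 1 + 1 ⊗ₜ[k] a ↔ a ∈ 𝒩.N i)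

/-- A `Γ`-graded object of the category of Yetter-Drinfeld modules over `Q` in `𝒞`, where `ι`
is the inclusion `ℤ^θ ⊆ Γ`; `Q` is `Γ`-graded through `ℕ₀^θ ⊆ ℤ^θ ⊆ Γ`. -/
structure GradedYDModule (𝒩 : PreNicholsSystem k H Q θ) {Γ : Type*} [AddCommGroup Γ]
    [DecidableEq Γ] (ι : (Fin θ → ℤ) →+ Γ) (V : Type*) [AddCommGroup V] [Module k V] where
  obj : ActCoact k H V
  str : ActCoact k Q V
  isYetterDrinfeldOver : IsYetterDrinfeldOver 𝒩.obj obj str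
  /-- The homogeneous components `V(γ)`. -/
  deg : Γ → Submodule k V
  isInternal : DirectSum.IsInternal deg
  deg_isSub : ∀ γ, obj.IsSub (deg γ)
  act_mem : ∀ (n : Fin θ → ℕ) (γ : Γ), ∀ a ∈ 𝒩.deg n, ∀ v ∈ deg γ,
    str.act (a ⊗ₜ v) ∈ deg (ι (fun j => (n j : ℤ)) + γ)
  coact_mem : ∀ γ, ∀ v ∈ deg γ, str.coact v ∈
    ⨆ (p : (Fin θ → ℕ) × Γ) (_ : ι (fun j => (p.1 j : ℤ)) + p.2 = γ),
      tensorSub (𝒩.deg p.1) (deg p.2)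

variable {𝒩 : PreNicholsSystem k H Q θ} {Γ : Type*} [AddCommGroup Γ] [DecidableEq Γ]
  {ι : (Fin θ → ℤ) →+ Γ} {V : Type*} [AddCommGroup V] [Module k V]

/-- `V` is generated by `V(γ)` as a `Q`-module: `Q · V(γ) = V`. -/
def GradedYDModule.GeneratedBy (M : GradedYDModule 𝒩 ι V) (γ : Γ) : Prop :=
  LinearMap.range (M.str.act ∘ₗ (M.deg γ).subtype.lTensor Q) = ⊤

/-- `V(γ)` as an object of `𝒞`. -/
def GradedYDModule.degObj (M : GradedYDModule 𝒩 ι V) (γ : Γ) : ActCoact k H (M.deg γ) :=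
  M.obj.sub (M.deg γ) (M.deg_isSub γ)

/-- The canonical projection `V → V(γ)`. -/
def GradedYDModule.proj (M : GradedYDModule 𝒩 ι V) (γ : Γ) : V →ₗ[k] M.deg γ :=
  DirectSum.component k Γ (fun γ' => M.deg γ') γ ∘ₗ
    (LinearEquiv.ofBijective (DirectSum.coeLinearMap M.deg) M.isInternal).symm.toLinearMap

/-- The Shapovalov morphism `f_V = (id_Q ⊗ π_0) δ_V^Q : V → Q ⊗ V(γ)`, for `V` generated by
`V(γ)`. -/
def GradedYDModule.shapovalov (M : GradedYDModule 𝒩 ι V) (γ : Γ) : V →ₗ[k] Q ⊗[k] M.deg γ :=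
  (M.proj γ).lTensor Q ∘ₗ M.str.coact

end Nichols

section Shuffles

/-- The defining relators of the braid group on `n + 1` strands; the letter `j : Fin n` stands for
the generator `c_{j+1}`. -/
def braidRels (n : ℕ) : Set (FreeGroup (Fin n)) :=
  {r | ∃ i j : Fin n, (i : ℕ) + 1 = j ∧
    r = FreeGroup.of i * FreeGroup.of j * FreeGroup.of i *
      (FreeGroup.of j * FreeGroup.of i * FreeGroup.of j)⁻¹} ∪
  {r | ∃ i j : Fin n, (i : ℕ) + 2 ≤ j ∧
    r = FreeGroup.of i * FreeGroup.of j * (FreeGroup.of j * FreeGroup.of i)⁻¹}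

/-- The braid group `𝔹_{n+1}` on `n + 1` strands. -/
abbrev BraidGroup (n : ℕ) : Type := PresentedGroup (braidRels n)

/-- The generator `c_{j+1}` of `𝔹_{n+1}`. -/
def braidGen (n : ℕ) (j : Fin n) : BraidGroup n := PresentedGroup.of j

/-- The adjacent transposition `s_{j+1} ∈ 𝕊_{n+1}`. -/
def adjSwap (n : ℕ) (j : Fin n) : Equiv.Perm (Fin (n + 1)) := Equiv.swap j.castSucc j.succ

/-- `l` is a reduced decomposition of `π`. -/
def IsReducedWord (n : ℕ) (π : Equiv.Perm (Fin (n + 1))) (l : List (Fin n)) : Prop :=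
  (l.map (adjSwap n)).prod = π ∧
    ∀ l' : List (Fin n), (l'.map (adjSwap n)).prod = π → l.length ≤ l'.length

theorem exists_isReducedWord (n : ℕ) (π : Equiv.Perm (Fin (n + 1))) :
    ∃ l, IsReducedWord n π l := by
  have h : ∃ l : List (Fin n), (l.map (adjSwap n)).prod = π := by
    have hm : π ∈ Submonoid.closure (Set.range fun i : Fin n => Equiv.swap i.castSucc i.succ) := by
      rw [Equiv.Perm.mclosure_swap_castSucc_succ]; trivial
    induction hm using Submonoid.closure_induction with
    | mem x hx => obtain ⟨i, rfl⟩ := hx; exact ⟨[i], by simp [adjSwap]⟩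
    | one => exact ⟨[], by simp⟩
    | mul x y _ _ hx hy =>
      obtain ⟨l, rfl⟩ := hx
      obtain ⟨l', rfl⟩ := hy
      exact ⟨l ++ l', by simp⟩
  obtain ⟨l, hl, hmin⟩ := WellFounded.has_min (measure (List.length (α := Fin n))).wf
    {l | (l.map (adjSwap n)).prod = π} h
  exact ⟨l, hl, fun l' hl' => not_lt.mp (hmin l' hl')⟩

/-- The Matsumoto section `𝕊_{n+1} → 𝔹_{n+1}`, `π ↦ c_π`: the product of the braid generators
along a reduced decomposition of `π` (all of them give the same element). -/
def matsumoto (n : ℕ) (π : Equiv.Perm (Fin (n + 1))) : BraidGroup n :=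
  ((exists_isReducedWord n π).choose.map (braidGen n)).prod

/-- The set of `π ∈ 𝕊_{n+1}` with `π(1) < ⋯ < π(n-m)`, `π(n-m+1) = n+1` and
`π(n-m+2) > ⋯ > π(n+1)`, for `0 ≤ m ≤ n`; empty for `m > n`. Here `{1, …, n+1}` is modelled
by `Fin (n + 1) = {0, …, n}`. -/
def shuffleSet (n m : ℕ) : Set (Equiv.Perm (Fin (n + 1))) :=
  {π | m ≤ n ∧
    (∀ a b : Fin (n + 1), a < b → (b : ℕ) + m < n → π a < π b) ∧
    (∀ a : Fin (n + 1), (a : ℕ) + m = n → π a = Fin.last n) ∧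
    (∀ a b : Fin (n + 1), a < b → n < (a : ℕ) + m → π b < π a)}

open Classical in
/-- `g_{n,m} = ∑_π c_{π⁻¹} ∈ 𝕜𝔹_{n+1}`, the sum over the permutations in `shuffleSet n m`. -/
def gElem (k : Type*) [Field k] (n m : ℕ) : MonoidAlgebra k (BraidGroup n) :=
  ∑ π : Equiv.Perm (Fin (n + 1)) with π ∈ shuffleSet n m,
    MonoidAlgebra.of k (BraidGroup n) (matsumoto n π⁻¹)

variable {k : Type*} [Field k] {N : Type*} [AddCommGroup N] [Module k N]

/-- The canonical isomorphism `N ⊗ N^{⊗n} ≅ N^{⊗(n+1)}`. -/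
def consEquiv (k N : Type*) [Field k] [AddCommGroup N] [Module k N] (n : ℕ) :
    N ⊗[k] (⨂[k]^n N) ≃ₗ[k] ⨂[k]^(n + 1) N :=
  TensorProduct.congr (PiTensorProduct.subsingletonEquiv (R := k) (s := fun _ : Fin 1 => N) 0).symm
      (LinearEquiv.refl k _) ≪≫ₗ
    TensorPower.mulEquiv ≪≫ₗ TensorPower.cast k N (Nat.add_comm 1 n)

theorem consEquiv_tmul_tprod (n : ℕ) (x : N) (f : Fin n → N) :
    consEquiv k N n (x ⊗ₜ PiTensorProduct.tprod k f) =
      PiTensorProduct.tprod k (Fin.cons x f : Fin (n + 1) → N) := by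
  have h : (PiTensorProduct.subsingletonEquiv (R := k) (s := fun _ : Fin 1 => N) 0).symm x =
      PiTensorProduct.tprod k (fun _ : Fin 1 => x) := by
    rw [LinearEquiv.symm_apply_eq, PiTensorProduct.subsingletonEquiv_apply_tprod]
  simp only [consEquiv, LinearEquiv.trans_apply, TensorProduct.congr_tmul, LinearEquiv.refl_apply,
    h, TensorPower.mulEquiv, PiTensorProduct.tmulEquiv_apply]
  erw [PiTensorProduct.reindex_tprod, TensorPower.cast_tprod]
  congr 1
  funext j
  refine Fin.cases ?_ (fun j => ?_) j
  · rfl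
  · have : Fin.cast (Nat.add_comm n 1) j.succ = Fin.natAdd 1 j := by
      ext; simp [Nat.add_comm]
    simp [this]

/-- The endomorphism `c ⊗ id ⊗ ⋯ ⊗ id` of `N^{⊗(n+2)}`. -/
def braidFirst (c : N ⊗[k] N →ₗ[k] N ⊗[k] N) (n : ℕ) : Module.End k (⨂[k]^(n + 2) N) :=
  let e : (N ⊗[k] N) ⊗[k] (⨂[k]^n N) ≃ₗ[k] ⨂[k]^(n + 2) N :=
    TensorProduct.assoc k N N (⨂[k]^n N) ≪≫ₗ
      TensorProduct.congr (LinearEquiv.refl k N) (consEquiv k N n) ≪≫ₗ consEquiv k N (n + 1)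
  e.toLinearMap ∘ₗ c.rTensor (⨂[k]^n N) ∘ₗ e.symm.toLinearMap

/-- The endomorphism `id^{⊗ j} ⊗ c ⊗ id^{⊗(n-1-j)}` of `N^{⊗(n+1)}`, for `0 ≤ j < n`. -/
def braidAt (c : N ⊗[k] N →ₗ[k] N ⊗[k] N) : (n : ℕ) → Fin n → Module.End k (⨂[k]^(n + 1) N)
  | 0 => fun j => j.elim0
  | n + 1 => Fin.cases (braidFirst c n) (fun j =>
      (consEquiv k N (n + 1)).toLinearMap ∘ₗ (braidAt c n j).lTensor N ∘ₗ
        (consEquiv k N (n + 1)).symm.toLinearMap)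

variable {Q : Type*} [Ring Q] [Algebra k Q]

/-- The multiplication `N^{⊗n} → Q`, `x_1 ⊗ ⋯ ⊗ x_n ↦ x_1 ⋯ x_n`, for a subspace `N` of an
algebra `Q`. -/
def mulTensor (N : Submodule k Q) (n : ℕ) : (⨂[k]^n N) →ₗ[k] Q :=
  PiTensorProduct.lift
    ((MultilinearMap.mkPiAlgebraFin k n Q).compLinearMap (fun _ => N.subtype))

theorem mulTensor_mem (N : Submodule k Q) (n : ℕ) (t : ⨂[k]^n N) : mulTensor N n t ∈ N ^ n := by
  induction t using PiTensorProduct.induction_on with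
  | smul_tprod r f =>
    rw [map_smul]
    refine Submodule.smul_mem _ r ?_
    simp only [mulTensor, PiTensorProduct.lift.tprod, MultilinearMap.compLinearMap_apply,
      MultilinearMap.mkPiAlgebraFin_apply]
    rw [Submodule.pow_eq_span_pow_set]
    exact Submodule.subset_span (Set.mem_pow.mpr ⟨fun j => ⟨f j, (f j).2⟩, rfl⟩)
  | add a b ha hb => rw [map_add]; exact Submodule.add_mem _ ha hb

/-- The multiplication map `N^{⊗n} → N^n`. -/
def mulPow (N : Submodule k Q) (n : ℕ) : (⨂[k]^n N) →ₗ[k] ↥(N ^ n) :=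
  (mulTensor N n).codRestrict _ (mulTensor_mem N n)

end Shuffles

end YDNichols

end

open YDNichols

/-! Write N for `N_i`, p for the projection of V onto V_0, and twist_x(q) = μ(c(x ⊗ q)). Elements of
N are primitive, so the Yetter-Drinfeld axiom for x in N acting on w has only two terms on each
side. After id ⊗ p one of these dies, because p kills N · V for degree reasons. With w = y · v, the
hexagon, naturality and c² = λ on N ⊗ V_0 turn the rest into a recursion: if (id ⊗ p)δ(y · v) = F(y)
⊗ v, then F(xy) = x F(y) - λ twist_x(F(y)). This is `projCoact_mul_act`.

The shuffle elements obey a matching recursion. In a permutation summed in g_{n+1,m+1} the smallest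
value stands either first or last; this gives g_{n+1,m+1} = shift(g_{n,m+1}) + c_{n+1}⋯c_1 ·
shift(g_{n,m}) (`gElem_succ_succ`), where Matsumoto's theorem makes π ↦ c_π computable. After
multiplication in Q the braid c_{n+1}⋯c_1 becomes twist_x (`mulTensor_cycleBraid`).

To descend along multiplication, g_{n,m} is realised by an operator defined on all of Q: G_m =
(-1)^m ∑_{b ≤ m} id * (S ∘ τ_b), with * the convolution product, S the antipode and τ_b the
projection onto degree b·α_i. From S(xy) = -twist_x(S(y)) one gets G_{m+1}(xy) = x G_{m+1}(y) +
twist_x(G_m(y)), and G_0 = id (`shuffleEnd_succ_mul`, `shuffleEnd_zero`). On N^{n+1} with m > n the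
sum is all of id * S = ε, hence zero (`shuffleEnd_eq_zero`). So G_m induces g_{n,m}
(`mulTensor_gElem`), and (1-λ) ∑ (-λ)^m G_m solves the recursion for F (`projCoact_pow_act`). -/

noncomputable section

namespace YDNichols

/-! ### The braiding of Yetter-Drinfeld modules: naturality, hexagon, Yang-Baxter, injectivity -/

section Braiding

variable {k H : Type*} [Field k] [Ring H] [HopfAlgebra k H]
variable {V W Z V' W' : Type*} [AddCommGroup V] [Module k V] [AddCommGroup W] [Module k W]
  [AddCommGroup Z] [Module k Z] [AddCommGroup V'] [Module k V'] [AddCommGroup W'] [Module k W']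

/-- The map `h ↦ h · v`. -/
def ActCoact.orbit (X : ActCoact k H V) (v : V) : H →ₗ[k] V :=
  X.act ∘ₗ (TensorProduct.mk k H V).flip v

@[simp] theorem ActCoact.orbit_apply (X : ActCoact k H V) (v : V) (h : H) :
    X.orbit v h = X.act (h ⊗ₜ v) := rfl

theorem braiding_tmul (X : ActCoact k H V) (Y : ActCoact k H W) (v : V) (w : W) :
    braiding X Y (v ⊗ₜ w) = (Y.orbit w).rTensor V (X.coact v) := by
  simp only [braiding, LinearMap.comp_apply, LinearMap.rTensor_tmul]
  induction X.coact v using TensorProduct.induction_on with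
  | zero => simp
  | tmul a b => simp
  | add a b ha hb => simp only [TensorProduct.add_tmul, map_add, ha, hb]

theorem ActCoact.orbit_map {Y : ActCoact k H W} {Y' : ActCoact k H W'} {g : W →ₗ[k] W'}
    (hg : g ∘ₗ Y.act = Y'.act ∘ₗ g.lTensor H) (w : W) : Y'.orbit (g w) = g ∘ₗ Y.orbit w := by
  ext h
  simpa using (LinearMap.congr_fun hg (h ⊗ₜ w)).symm

theorem ActCoact.orbit_tensor (X : ActCoact k H V) (Y : ActCoact k H W) (v : V) (w : W) :
    (X.tensor Y).orbit (v ⊗ₜ w) =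
      TensorProduct.map (X.orbit v) (Y.orbit w) ∘ₗ Coalgebra.comul := by
  ext h
  simp only [ActCoact.orbit_apply, ActCoact.tensor, LinearMap.comp_apply, LinearMap.rTensor_tmul]
  induction Coalgebra.comul (R := k) h using TensorProduct.induction_on with
  | zero => simp
  | tmul a b => simp [middle]
  | add a b ha hb => simp only [TensorProduct.add_tmul, map_add, ha, hb]

/-- The braiding reads only the coaction of its left factor and the action of its right factor, so
colinearity of `f` and linearity of `g` are enough. -/
theorem braiding_natural {X : ActCoact k H V} {X' : ActCoact k H V'}
    {Y : ActCoact k H W} {Y' : ActCoact k H W'} {f : V →ₗ[k] V'} {g : W →ₗ[k] W'}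
    (hf : X'.coact ∘ₗ f = f.lTensor H ∘ₗ X.coact)
    (hg : g ∘ₗ Y.act = Y'.act ∘ₗ g.lTensor H) :
    braiding X' Y' ∘ₗ TensorProduct.map f g = TensorProduct.map g f ∘ₗ braiding X Y := by
  ext v w
  have hv := LinearMap.congr_fun hf v
  simp only [LinearMap.comp_apply] at hv
  simp only [TensorProduct.AlgebraTensorModule.curry_apply, TensorProduct.curry_apply,
    LinearMap.coe_restrictScalars, LinearMap.comp_apply, TensorProduct.map_tmul, braiding_tmul,
    hv, ActCoact.orbit_map hg]
  simp only [LinearMap.lTensor, LinearMap.rTensor, TensorProduct.map_map, LinearMap.comp_id,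
    LinearMap.id_comp]

theorem braiding_natural_right (X : ActCoact k H V)
    {Y : ActCoact k H W} {Y' : ActCoact k H W'} {g : W →ₗ[k] W'}
    (hg : g ∘ₗ Y.act = Y'.act ∘ₗ g.lTensor H) (v : V) (w : W) :
    braiding X Y' (v ⊗ₜ g w) = g.rTensor V (braiding X Y (v ⊗ₜ w)) :=
  LinearMap.congr_fun (braiding_natural (X := X) (X' := X) (f := LinearMap.id) (by simp) hg)
    (v ⊗ₜ w)

theorem braiding_natural_left {X : ActCoact k H V} {X' : ActCoact k H V'}
    (Y : ActCoact k H W) {f : V →ₗ[k] V'}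
    (hf : X'.coact ∘ₗ f = f.lTensor H ∘ₗ X.coact) (v : V) (w : W) :
    braiding X' Y (f v ⊗ₜ w) = f.lTensor W (braiding X Y (v ⊗ₜ w)) :=
  LinearMap.congr_fun (braiding_natural (Y := Y) (Y' := Y) (g := LinearMap.id) hf (by simp))
    (v ⊗ₜ w)

/-- Each of the two subspaces needs only half of being a subobject; this permits `A` to be a power
of `N`, for which only stability under the action is established. -/
theorem braiding_mem {X : ActCoact k H V} {Y : ActCoact k H W} {A : Submodule k W}
    {B : Submodule k V} (hA : ∀ (h : H), ∀ a ∈ A, Y.act (h ⊗ₜ a) ∈ A)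
    (hB : ∀ b ∈ B, X.coact b ∈ LinearMap.range (B.subtype.lTensor H))
    {b : V} (hb : b ∈ B) {a : W} (ha : a ∈ A) :
    braiding X Y (b ⊗ₜ a) ∈ LinearMap.range (TensorProduct.map A.subtype B.subtype) := by
  obtain ⟨t, ht⟩ := hB b hb
  refine ⟨TensorProduct.map ((Y.orbit a).codRestrict A fun h => hA h a ha) LinearMap.id t, ?_⟩
  rw [braiding_tmul, ← ht, LinearMap.lTensor, LinearMap.rTensor, TensorProduct.map_map,
    TensorProduct.map_map]
  rfl

/-- The braiding with a tensor product in the second variable. -/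
theorem braiding_tensor {X : ActCoact k H V}
    (hX : X.IsModComod) (Y : ActCoact k H W) (Z' : ActCoact k H Z) :
    (TensorProduct.assoc k W Z V).toLinearMap ∘ₗ braiding X (Y.tensor Z') =
      (braiding X Z').lTensor W ∘ₗ (TensorProduct.assoc k W V Z).toLinearMap ∘ₗ
        (braiding X Y).rTensor Z ∘ₗ (TensorProduct.assoc k V W Z).symm.toLinearMap := by
  ext x y z
  simp only [TensorProduct.AlgebraTensorModule.curry_apply, TensorProduct.curry_apply,
    LinearMap.coe_restrictScalars, LinearMap.comp_apply, LinearEquiv.coe_coe,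
    TensorProduct.assoc_symm_tmul, LinearMap.rTensor_tmul, braiding_tmul, ActCoact.orbit_tensor]
  have hx := LinearMap.congr_fun hX.coassoc x
  simp only [LinearMap.comp_apply, LinearEquiv.coe_coe] at hx
  have h1 : ∀ t : H ⊗[k] V, (braiding X Z').lTensor W (TensorProduct.assoc k W V Z
      ((Y.orbit y).rTensor V t ⊗ₜ z)) =
      TensorProduct.map (Y.orbit y) ((Z'.orbit z).rTensor V) (X.coact.lTensor H t) := by
    intro t
    induction t using TensorProduct.induction_on with
    | zero => simp
    | tmul a b => simp [braiding_tmul]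
    | add a b ha hb => simp only [TensorProduct.add_tmul, map_add, ha, hb]
  have h2 : ∀ t : (H ⊗[k] H) ⊗[k] V, TensorProduct.assoc k W Z V
      ((TensorProduct.map (Y.orbit y) (Z'.orbit z)).rTensor V t) =
      TensorProduct.map (Y.orbit y) ((Z'.orbit z).rTensor V) (TensorProduct.assoc k H H V t) := by
    intro t
    refine LinearMap.congr_fun (f := (TensorProduct.assoc k W Z V).toLinearMap ∘ₗ
      (TensorProduct.map (Y.orbit y) (Z'.orbit z)).rTensor V)
      (g := TensorProduct.map (Y.orbit y) ((Z'.orbit z).rTensor V) ∘ₗ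
        (TensorProduct.assoc k H H V).toLinearMap) ?_ t
    ext a b c
    simp
  rw [h1, ← hx, ← h2, LinearMap.rTensor_comp_apply]

/-- Letting the first leg of the compatibility of `X` at h ⊗ x act on y gives exactly this identity.
-/
theorem braiding_act_linear {X : ActCoact k H V} (hX : X.IsYetterDrinfeld)
    {Y : ActCoact k H W} (hY : Y.IsModComod) :
    braiding X Y ∘ₗ (X.tensor Y).act = (Y.tensor X).act ∘ₗ (braiding X Y).lTensor H := by
  ext h x y
  have hc := LinearMap.congr_fun hX.compat (h ⊗ₜ x)
  simp only [LinearMap.comp_apply, LinearEquiv.coe_coe, TensorProduct.map_tmul,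
    LinearMap.rTensor_tmul] at hc
  simp only [TensorProduct.AlgebraTensorModule.curry_apply, TensorProduct.curry_apply,
    LinearMap.coe_restrictScalars, LinearMap.comp_apply, LinearMap.lTensor_tmul, braiding_tmul,
    ActCoact.tensor, LinearMap.rTensor_tmul]
  have key := congrArg ((Y.orbit y).rTensor V) hc
  convert key.symm using 1
  · induction Coalgebra.comul (R := k) h using TensorProduct.induction_on with
    | zero => simp
    | add a b ha hb => simp only [TensorProduct.add_tmul, map_add, ha, hb]
    | tmul a b =>
      simp only [middle, LinearMap.comp_apply, LinearEquiv.coe_coe, TensorProduct.assoc_tmul,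
        LinearMap.lTensor_tmul, TensorProduct.assoc_symm_tmul, LinearMap.rTensor_tmul,
        TensorProduct.comm_tmul, TensorProduct.map_tmul, braiding_tmul]
      induction X.coact (X.act (a ⊗ₜ[k] x)) using TensorProduct.induction_on with
      | zero => simp
      | add a b ha hb => simp only [TensorProduct.add_tmul, map_add, ha, hb]
      | tmul c d => simp [hY.mul_act]
  · induction X.coact x using TensorProduct.induction_on with
    | zero => simp
    | add a b ha hb => simp only [TensorProduct.tmul_add, map_add, ha, hb]
    | tmul c d =>
      induction Coalgebra.comul (R := k) h using TensorProduct.induction_on with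
      | zero => simp
      | add a b ha hb => simp only [TensorProduct.add_tmul, map_add, ha, hb]
      | tmul a b => simp [middle, hY.mul_act]

/-- `c ⊗ id` on `V ⊗ (V ⊗ V)`. -/
def braidLeft (c : V ⊗[k] V →ₗ[k] V ⊗[k] V) (T : Type*) [AddCommGroup T] [Module k T] :
    V ⊗[k] (V ⊗[k] T) →ₗ[k] V ⊗[k] (V ⊗[k] T) :=
  (TensorProduct.assoc k V V T).toLinearMap ∘ₗ c.rTensor T ∘ₗ
    (TensorProduct.assoc k V V T).symm.toLinearMap

/-- Naturality of c_{X, X ⊗ X} with respect to the `H`-linear map c_{X,X}, with c_{X, X ⊗ X}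
expanded by the hexagon. -/
theorem yangBaxter {X : ActCoact k H V} (hX : X.IsYetterDrinfeld) :
    braidLeft (braiding X X) V ∘ₗ (braiding X X).lTensor V ∘ₗ braidLeft (braiding X X) V =
      (braiding X X).lTensor V ∘ₗ braidLeft (braiding X X) V ∘ₗ (braiding X X).lTensor V := by
  have h1 := braiding_tensor hX.toIsModComod X X
  have h2 : braiding X (X.tensor X) ∘ₗ (braiding X X).lTensor V =
      (braiding X X).rTensor V ∘ₗ braiding X (X.tensor X) :=
    braiding_natural (X := X) (X' := X) (f := LinearMap.id) (by simp)
      (braiding_act_linear hX hX.toIsModComod)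
  have h3 : braiding X (X.tensor X) = (TensorProduct.assoc k V V V).symm.toLinearMap ∘ₗ
      (braiding X X).lTensor V ∘ₗ braidLeft (braiding X X) V := by
    rw [braidLeft, ← h1, ← LinearMap.comp_assoc]
    simp
  rw [h3] at h2
  have h4 := congrArg (fun f => (TensorProduct.assoc k V V V).toLinearMap ∘ₗ f) h2
  simp only [← LinearMap.comp_assoc, LinearEquiv.comp_coe, LinearEquiv.symm_trans_self,
    LinearEquiv.refl_toLinearMap, LinearMap.id_comp] at h4
  simp only [braidLeft, ← LinearMap.comp_assoc] at h4 ⊢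
  exact h4.symm

/-- The antipode is injective and reverses products, so T(h₂)h₁ = ε(h) follows from S(h₁)h₂ = ε(h).
-/
theorem antipode_inv_mul {T : H →ₗ[k] H}
    (hT : ∀ h, HopfAlgebra.antipode k (T h) = h)
    (hinj : Function.Injective (HopfAlgebra.antipode k : H →ₗ[k] H)) (h : H) :
    (LinearMap.mul' k H ∘ₗ T.rTensor H ∘ₗ (TensorProduct.comm k H H).toLinearMap)
      (Coalgebra.comul h) = algebraMap k H (Coalgebra.counit h) := by
  apply hinj
  rw [Algebra.algebraMap_eq_smul_one, map_smul, HopfAlgebra.antipode_one,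
    ← Algebra.algebraMap_eq_smul_one, ← HopfAlgebra.mul_antipode_rTensor_comul_apply]
  induction Coalgebra.comul (R := k) h using TensorProduct.induction_on with
  | zero => simp
  | tmul a b => simp [HopfAlgebra.antipode_mul_antidistrib, hT]
  | add a b ha hb => simp only [map_add, ha, hb]

/-- A left inverse is w ⊗ v ↦ v₍₀₎ ⊗ S⁻¹(v₍₋₁₎) · w; `J` is this map before the final flip. -/
theorem braiding_injective (hH : Function.Bijective (HopfAlgebra.antipode k : H →ₗ[k] H))
    {X : ActCoact k H V} (hX : X.IsModComod) {Y : ActCoact k H W} (hY : Y.IsModComod) :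
    Function.Injective (braiding X Y) := by
  let e := LinearEquiv.ofBijective _ hH
  let T : H →ₗ[k] H := e.symm.toLinearMap
  have hT : ∀ h, HopfAlgebra.antipode k (T h) = h := fun h => e.apply_symm_apply h
  let M : H ⊗[k] H →ₗ[k] H :=
    LinearMap.mul' k H ∘ₗ T.rTensor H ∘ₗ (TensorProduct.comm k H H).toLinearMap
  let J : W ⊗[k] V →ₗ[k] W ⊗[k] V :=
    Y.act.rTensor V ∘ₗ (T.rTensor W).rTensor V ∘ₗ
      (TensorProduct.comm k W H).toLinearMap.rTensor V ∘ₗ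
      (TensorProduct.assoc k W H V).symm.toLinearMap ∘ₗ X.coact.lTensor W
  have hJ : ∀ (w : W) (t : H ⊗[k] V), J ((Y.orbit w).rTensor V t) =
      (Y.orbit w ∘ₗ M).rTensor V ((TensorProduct.assoc k H H V).symm (X.coact.lTensor H t)) := by
    intro w t
    induction t using TensorProduct.induction_on with
    | zero => simp
    | add a b ha hb => simp only [map_add, ha, hb]
    | tmul a b =>
      simp only [J, M, LinearMap.comp_apply, LinearMap.rTensor_tmul, LinearMap.lTensor_tmul,
        LinearEquiv.coe_coe]
      induction X.coact b using TensorProduct.induction_on with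
      | zero => simp
      | add a b ha hb => simp only [TensorProduct.tmul_add, map_add, ha, hb]
      | tmul c d => simp [hY.mul_act]
  refine Function.LeftInverse.injective (g := (TensorProduct.comm k W V) ∘ J) ?_
  intro s
  refine LinearMap.congr_fun (f := (TensorProduct.comm k W V).toLinearMap ∘ₗ J ∘ₗ braiding X Y)
    (g := LinearMap.id) ?_ s
  ext v w
  simp only [TensorProduct.AlgebraTensorModule.curry_apply, TensorProduct.curry_apply,
    LinearMap.coe_restrictScalars, LinearMap.comp_apply, LinearMap.id_apply, LinearEquiv.coe_coe]
  have hco := LinearMap.congr_fun hX.coassoc v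
  have hcu := LinearMap.congr_fun hX.counit_coact v
  simp only [LinearMap.comp_apply, LinearEquiv.coe_coe, LinearMap.id_apply] at hco hcu
  have hM : M ∘ₗ Coalgebra.comul = Algebra.linearMap k H ∘ₗ Coalgebra.counit := by
    ext h
    exact antipode_inv_mul hT hH.1 h
  rw [braiding_tmul, hJ, ← hco, LinearEquiv.symm_apply_apply, ← LinearMap.rTensor_comp_apply,
    LinearMap.comp_assoc, hM]
  conv_rhs => rw [← hcu]
  induction X.coact v using TensorProduct.induction_on with
  | zero => simp
  | add a b ha hb => simp only [TensorProduct.add_tmul, map_add, ha, hb]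
  | tmul a b =>
    simp [Algebra.algebraMap_eq_smul_one, hY.one_act, ← TensorProduct.smul_tmul']

end Braiding

/-! ### Inversions, reduced words and Matsumoto's theorem -/

section Matsumoto

variable {n : ℕ}

/-- The set of inversions of a permutation. -/
def inversions (π : Equiv.Perm (Fin n)) : Finset (Fin n × Fin n) :=
  {p | p.1 < p.2 ∧ π p.2 < π p.1}

/-- The number of inversions of a permutation. -/
def inv (π : Equiv.Perm (Fin n)) : ℕ := (inversions π).card

theorem mem_inversions {π : Equiv.Perm (Fin n)} {a b : Fin n} :
    (a, b) ∈ inversions π ↔ a < b ∧ π b < π a := by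
  simp [inversions]

theorem inv_eq_sum (π : Equiv.Perm (Fin n)) :
    inv π = ∑ a, ∑ b, if a < b ∧ π b < π a then 1 else 0 := by
  rw [inv, inversions, Finset.card_filter, ← Finset.univ_product_univ, Finset.sum_product]

theorem adjSwap_val (j : Fin n) (u : Fin (n + 1)) : (adjSwap n j u : ℕ) =
    if (u : ℕ) = j then (j : ℕ) + 1 else if (u : ℕ) = j + 1 then (j : ℕ) else u := by
  simp only [adjSwap, Equiv.swap_apply_def, Fin.ext_iff, Fin.val_castSucc, Fin.val_succ]
  split_ifs <;> simp

theorem adjSwap_mul_self (j : Fin n) : adjSwap n j * adjSwap n j = 1 :=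
  Equiv.swap_mul_self _ _

@[simp] theorem adjSwap_mul_cancel (j : Fin n) (π : Equiv.Perm (Fin (n + 1))) :
    adjSwap n j * (adjSwap n j * π) = π := by
  rw [← mul_assoc, adjSwap_mul_self, one_mul]

theorem adjSwap_inv (j : Fin n) : (adjSwap n j)⁻¹ = adjSwap n j :=
  Equiv.swap_inv _ _

theorem adjSwap_braid {i j : Fin n} (h : (i : ℕ) + 1 = j) :
    adjSwap n i * (adjSwap n j * adjSwap n i) = adjSwap n j * (adjSwap n i * adjSwap n j) := by
  ext u
  have hu : (u : ℕ) = i ∨ (u : ℕ) = i + 1 ∨ (u : ℕ) = i + 1 + 1 ∨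
      ((u : ℕ) ≠ i ∧ (u : ℕ) ≠ i + 1 ∧ (u : ℕ) ≠ i + 1 + 1) := by omega
  have h0 : (i : ℕ) ≠ i + 1 + 1 := by omega
  rcases hu with hu | hu | hu | hu <;> simp [adjSwap_val, hu, ← h, h0, h0.symm]

theorem adjSwap_comm {i j : Fin n} (h : (i : ℕ) + 2 ≤ j) :
    adjSwap n i * adjSwap n j = adjSwap n j * adjSwap n i := by
  ext u
  simp only [Equiv.Perm.mul_apply, adjSwap_val]
  split_ifs <;> omega

/-- Left multiplication exchanges the adjacent values j and j + 1, so the only pair of positions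
whose order changes is the one carrying these two values. -/
theorem inv_adjSwap_mul_of_lt (π : Equiv.Perm (Fin (n + 1))) (j : Fin n)
    (h : π⁻¹ j.castSucc < π⁻¹ j.succ) : inv (adjSwap n j * π) = inv π + 1 := by
  have hset : inversions (adjSwap n j * π) =
      insert (π⁻¹ j.castSucc, π⁻¹ j.succ) (inversions π) := by
    ext ⟨a, b⟩
    have h1 : a = π⁻¹ j.castSucc ↔ (π a : ℕ) = j := by
      rw [Equiv.Perm.eq_inv_iff_eq, Fin.ext_iff, Fin.val_castSucc]
    have h2 : b = π⁻¹ j.succ ↔ (π b : ℕ) = j + 1 := by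
      rw [Equiv.Perm.eq_inv_iff_eq, Fin.ext_iff, Fin.val_succ]
    have h3 : a < b → ¬((π b : ℕ) = j ∧ (π a : ℕ) = j + 1) := by
      rintro hab ⟨hb, ha⟩
      have hb' : b = π⁻¹ j.castSucc := by
        rw [Equiv.Perm.eq_inv_iff_eq]; exact Fin.ext hb
      have ha' : a = π⁻¹ j.succ := by
        rw [Equiv.Perm.eq_inv_iff_eq]; exact Fin.ext ha
      exact absurd h (not_lt.mpr (ha' ▸ hb' ▸ hab.le))
    have h4 : a < b → (π a : ℕ) ≠ π b := fun hab he =>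
      hab.ne (π.injective (Fin.ext he))
    have h5 : a = π⁻¹ j.castSucc ∧ b = π⁻¹ j.succ → a < b := by
      rintro ⟨rfl, rfl⟩; exact h
    rw [Finset.mem_insert, mem_inversions, mem_inversions, Prod.mk.injEq, Equiv.Perm.mul_apply,
      Equiv.Perm.mul_apply, Fin.lt_def (a := adjSwap n j (π b)), adjSwap_val, adjSwap_val,
      Fin.lt_def (a := π b)]
    rw [h1, h2] at *
    by_cases hab : a < b
    · have := h3 hab
      have := h4 hab
      simp only [hab, true_and]
      split_ifs <;> omega
    · have : ¬ ((π a : ℕ) = j ∧ (π b : ℕ) = j + 1) := fun hh => hab (h5 hh)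
      simp only [hab, false_and, or_false, false_iff]
      exact this
  rw [inv, hset, Finset.card_insert_of_notMem, inv]
  rw [mem_inversions, not_and, not_lt]
  intro _
  simpa using (Fin.castSucc_lt_succ (i := j)).le

theorem inv_eq_of_descent (π : Equiv.Perm (Fin (n + 1))) (j : Fin n)
    (h : π⁻¹ j.succ < π⁻¹ j.castSucc) : inv π = inv (adjSwap n j * π) + 1 := by
  have := inv_adjSwap_mul_of_lt (adjSwap n j * π) j (by
    simpa [mul_inv_rev, adjSwap_inv, adjSwap] using h)
  rwa [adjSwap_mul_cancel] at this

theorem descent_of_inv_lt {π : Equiv.Perm (Fin (n + 1))} {j : Fin n}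
    (h : inv (adjSwap n j * π) < inv π) : π⁻¹ j.succ < π⁻¹ j.castSucc := by
  rcases lt_trichotomy (π⁻¹ j.succ) (π⁻¹ j.castSucc) with h1 | h1 | h1
  · exact h1
  · exact absurd (π⁻¹.injective h1) (Fin.castSucc_lt_succ).ne'
  · have := inv_adjSwap_mul_of_lt π j h1
    omega

theorem inv_le_adjSwap_mul (π : Equiv.Perm (Fin (n + 1))) (j : Fin n) :
    inv (adjSwap n j * π) ≤ inv π + 1 := by
  by_contra! h
  have h1 := descent_of_inv_lt (π := adjSwap n j * π) (j := j) (by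
    rw [adjSwap_mul_cancel]; omega)
  have h2 := inv_eq_of_descent _ _ h1
  rw [adjSwap_mul_cancel] at h2
  omega

@[simp] theorem inv_one : inv (1 : Equiv.Perm (Fin n)) = 0 := by
  rw [inv, inversions, Finset.card_eq_zero, Finset.filter_eq_empty_iff]
  rintro ⟨a, b⟩ _ ⟨h1, h2⟩
  exact lt_asymm h1 h2

theorem inv_prod_le (l : List (Fin n)) : inv (l.map (adjSwap n)).prod ≤ l.length := by
  induction l with
  | nil => simp
  | cons j l ih =>
    rw [List.map_cons, List.prod_cons, List.length_cons]
    exact (inv_le_adjSwap_mul _ _).trans (by omega)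

/-- Without a descent π⁻¹ would be increasing, and a finite chain has no order automorphism but the
identity. -/
theorem exists_descent {π : Equiv.Perm (Fin (n + 1))} (h : π ≠ 1) :
    ∃ j : Fin n, π⁻¹ j.succ < π⁻¹ j.castSucc := by
  by_contra! hd
  have hmono : StrictMono (π⁻¹ : Equiv.Perm (Fin (n + 1))) :=
    Fin.strictMono_iff_lt_succ.mpr fun j =>
      (hd j).lt_of_ne fun he => (Fin.castSucc_lt_succ (i := j)).ne (π⁻¹.injective he)
  have : π⁻¹ = 1 := by
    ext1 x
    have := congrArg (fun f : Fin (n + 1) ≃o Fin (n + 1) => f x) (Subsingleton.elim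
      (StrictMono.orderIsoOfSurjective _ hmono π⁻¹.surjective) (OrderIso.refl (Fin (n + 1))))
    simpa using this
  exact h (inv_eq_one.mp this)

/-- Removing descents one at a time lowers the inversion number by exactly one. With `inv_prod_le`,
the inversion number is the Coxeter length, so reducedness can be checked by counting. -/
theorem exists_word_length_eq_inv (π : Equiv.Perm (Fin (n + 1))) :
    ∃ l : List (Fin n), (l.map (adjSwap n)).prod = π ∧ l.length = inv π := by
  induction hm : inv π using Nat.strong_induction_on generalizing π with
  | _ m ih =>
    by_cases h1 : π = 1
    · subst h1
      exact ⟨[], by simp, by simpa using hm⟩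
    · obtain ⟨j, hj⟩ := exists_descent h1
      have h2 := inv_eq_of_descent π j hj
      obtain ⟨l, hl, hlen⟩ := ih (inv (adjSwap n j * π)) (by omega) _ rfl
      exact ⟨j :: l, by rw [List.map_cons, List.prod_cons, hl, adjSwap_mul_cancel],
        by rw [List.length_cons]; omega⟩

theorem braidGen_braid {i j : Fin n} (h : (i : ℕ) + 1 = j) :
    braidGen n i * braidGen n j * braidGen n i = braidGen n j * braidGen n i * braidGen n j := by
  have := PresentedGroup.one_of_mem (rels := braidRels n) (Or.inl ⟨i, j, h, rfl⟩)
  rw [map_mul, map_inv, mul_inv_eq_one] at this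
  simpa only [map_mul] using! this

theorem braidGen_comm {i j : Fin n} (h : (i : ℕ) + 2 ≤ j) :
    braidGen n i * braidGen n j = braidGen n j * braidGen n i := by
  have := PresentedGroup.one_of_mem (rels := braidRels n) (Or.inr ⟨i, j, h, rfl⟩)
  rw [map_mul, map_inv, mul_inv_eq_one] at this
  simpa only [map_mul] using! this

/-- Matsumoto's theorem for the symmetric group. -/
theorem braid_prod_eq_of_reduced (m : ℕ) : ∀ l l' : List (Fin n), l.length = m → l'.length = m →
    (l.map (adjSwap n)).prod = (l'.map (adjSwap n)).prod →
    inv (l.map (adjSwap n)).prod = m →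
    (l.map (braidGen n)).prod = (l'.map (braidGen n)).prod := by
  induction m using Nat.strong_induction_on with
  | _ m ih =>
  intro l l' hl hl' he hm
  rcases l with _ | ⟨i, u⟩
  · obtain rfl : l' = [] := List.length_eq_zero_iff.mp (by simp_all)
    rfl
  rcases l' with _ | ⟨j, v⟩
  · simp only [List.length_nil, List.length_cons] at hl hl'
    omega
  wlog hij : (i : ℕ) ≤ j generalizing i j u v
  · exact (this j v hl' (he ▸ hm) i u hl he.symm (by omega)).symm
  set π := ((i :: u).map (adjSwap n)).prod with hπ
  have hu : (u.map (adjSwap n)).prod = adjSwap n i * π := by simp [hπ]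
  have hv : (v.map (adjSwap n)).prod = adjSwap n j * π := by simp [he]
  simp only [List.length_cons] at hl hl'
  have hui := inv_prod_le u
  have hvi := inv_prod_le v
  rw [hu] at hui
  rw [hv] at hvi
  have hdi := descent_of_inv_lt (π := π) (j := i) (by omega)
  have hdj := descent_of_inv_lt (π := π) (j := j) (by omega)
  have hi := inv_eq_of_descent π i hdi
  have hj := inv_eq_of_descent π j hdj
  simp only [List.map_cons, List.prod_cons]
  rcases hij.eq_or_lt with hij | hij
  · obtain rfl := Fin.ext hij
    rw [ih u.length (by omega) u v rfl (by omega) (hu.trans hv.symm) (by rw [hu]; omega)]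
  have hswap : ∀ (a : Fin n) (b : Fin (n + 1)), (b : ℕ) ≠ a → (b : ℕ) ≠ a + 1 →
      adjSwap n a b = b := by
    intro a b h1 h2
    ext
    rw [adjSwap_val, if_neg h1, if_neg h2]
  -- Both letters are descents of π, so π has a reduced word starting with the longest element of
  -- ⟨s_i, s_j⟩. Let x be a reduced word for the remaining factor. By induction the tails u and v
  -- may be replaced by words ending in x, and a single braid relation (adjacent letters) or
  -- commutation (distant letters) then joins the two sides.
  rcases (Nat.succ_le_of_lt hij).eq_or_lt with hij' | hij'
  · have e1 : j.castSucc = i.succ := Fin.ext (by simp; omega)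
    have f1 : adjSwap n i i.succ = i.castSucc := Equiv.swap_apply_right _ _
    have f2 : adjSwap n i j.succ = j.succ := hswap _ _ (by simp; omega) (by simp; omega)
    have f3 : adjSwap n j i.castSucc = i.castSucc := hswap _ _ (by simp; omega) (by simp; omega)
    have f4 : adjSwap n j i.succ = j.succ := by rw [← e1]; exact Equiv.swap_apply_left _ _
    rw [e1] at hdj
    have k1 := inv_eq_of_descent (adjSwap n i * π) j (by
      rw [mul_inv_rev, adjSwap_inv, Equiv.Perm.mul_apply, Equiv.Perm.mul_apply, e1, f1, f2]
      exact hdj.trans hdi)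
    have k2 := inv_eq_of_descent (adjSwap n j * (adjSwap n i * π)) i (by
      rw [mul_inv_rev, mul_inv_rev, adjSwap_inv, adjSwap_inv, Equiv.Perm.mul_apply,
        Equiv.Perm.mul_apply, Equiv.Perm.mul_apply, Equiv.Perm.mul_apply, f3, f4, f2,
        adjSwap, Equiv.swap_apply_left]
      exact hdj)
    obtain ⟨x, hx, hxl⟩ :=
      exists_word_length_eq_inv (adjSwap n i * (adjSwap n j * (adjSwap n i * π)))
    have g1 := ih u.length (by omega) u (j :: i :: x) rfl (by simp; omega) (by simp [hx, hu])
      (by rw [hu]; omega)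
    have g2 := ih v.length (by omega) v (i :: j :: x) rfl (by simp; omega) (by
      simp only [List.map_cons, List.prod_cons, hx, hv]
      have := congrArg (· * π) (adjSwap_braid hij')
      simp only [mul_assoc] at this
      rw [this]; simp) (by rw [hv]; omega)
    rw [g1, g2]
    simp only [List.map_cons, List.prod_cons, ← mul_assoc, braidGen_braid hij']
  · have f1 : adjSwap n i j.castSucc = j.castSucc := hswap _ _ (by simp; omega) (by simp; omega)
    have f2 : adjSwap n i j.succ = j.succ := hswap _ _ (by simp; omega) (by simp; omega)
    have k1 := inv_eq_of_descent (adjSwap n i * π) j (by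
      rw [mul_inv_rev, adjSwap_inv, Equiv.Perm.mul_apply, Equiv.Perm.mul_apply, f1, f2]
      exact hdj)
    obtain ⟨x, hx, hxl⟩ := exists_word_length_eq_inv (adjSwap n j * (adjSwap n i * π))
    have g1 := ih u.length (by omega) u (j :: x) rfl (by simp; omega) (by simp [hx, hu])
      (by rw [hu]; omega)
    have g2 := ih v.length (by omega) v (i :: x) rfl (by simp; omega) (by
      simp only [List.map_cons, List.prod_cons, hx, hv]
      have := congrArg (· * π) (adjSwap_comm (n := n) (i := i) (j := j) hij')
      simp only [mul_assoc] at this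
      rw [← this]; simp) (by rw [hv]; omega)
    rw [g1, g2]
    simp only [List.map_cons, List.prod_cons, ← mul_assoc,
      braidGen_comm (n := n) (i := i) (j := j) hij']

/-- This makes the reduced word chosen in the definition irrelevant: any word with as many letters
as π has inversions computes c_π. -/
theorem matsumoto_eq {π : Equiv.Perm (Fin (n + 1))} {l : List (Fin n)}
    (h : (l.map (adjSwap n)).prod = π) (hl : l.length = inv π) :
    matsumoto n π = (l.map (braidGen n)).prod := by
  obtain ⟨h1, h2⟩ := (exists_isReducedWord n π).choose_spec
  have h3 := inv_prod_le (exists_isReducedWord n π).choose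
  rw [h1] at h3
  have h4 := h2 l h
  exact braid_prod_eq_of_reduced (inv π) _ _ (by omega) hl (h1.trans h.symm) (by rw [h1])

end Matsumoto

/-! ### The recursion for the shuffle elements -/

section ShuffleRecursion

variable {n : ℕ}

/-- The extension of a permutation of `{0, …, n}` to `{0, …, n + 1}` by fixing `0`. -/
def shiftPerm (σ : Equiv.Perm (Fin n)) : Equiv.Perm (Fin (n + 1)) :=
  Equiv.Perm.decomposeFin.symm (0, σ)

@[simp] theorem shiftPerm_zero (σ : Equiv.Perm (Fin n)) : shiftPerm σ 0 = 0 := by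
  simp [shiftPerm]

@[simp] theorem shiftPerm_succ (σ : Equiv.Perm (Fin n)) (a : Fin n) :
    shiftPerm σ a.succ = (σ a).succ := by
  simp [shiftPerm]

theorem shiftPerm_injective : Function.Injective (shiftPerm (n := n)) := fun σ τ h => by
  simpa [shiftPerm] using h

theorem exists_shiftPerm {π : Equiv.Perm (Fin (n + 1))} (h : π 0 = 0) :
    ∃ σ, shiftPerm σ = π := by
  obtain ⟨⟨p, σ⟩, rfl⟩ := Equiv.Perm.decomposeFin.symm.surjective π
  obtain rfl : p = 0 := by simpa using h
  exact ⟨σ, rfl⟩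

theorem shiftPerm_mul (σ τ : Equiv.Perm (Fin n)) :
    shiftPerm (σ * τ) = shiftPerm σ * shiftPerm τ := by
  ext1 a
  refine Fin.cases ?_ (fun a => ?_) a <;> simp

theorem shiftPerm_one : shiftPerm (1 : Equiv.Perm (Fin n)) = 1 := by
  ext1 a
  refine Fin.cases ?_ (fun a => ?_) a <;> simp

theorem shiftPerm_inv (σ : Equiv.Perm (Fin n)) : (shiftPerm σ)⁻¹ = shiftPerm σ⁻¹ := by
  rw [inv_eq_iff_mul_eq_one, ← shiftPerm_mul, mul_inv_cancel, shiftPerm_one]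

theorem shiftPerm_adjSwap (j : Fin n) : shiftPerm (adjSwap n j) = adjSwap (n + 1) j.succ := by
  ext a
  refine Fin.cases ?_ (fun a => ?_) a
  · simp [adjSwap_val]
  · simp only [shiftPerm_succ, Fin.val_succ, adjSwap_val, Nat.add_right_cancel_iff]
    split_ifs <;> rfl

theorem shiftPerm_prod (l : List (Fin n)) : shiftPerm (l.map (adjSwap n)).prod =
    ((l.map Fin.succ).map (adjSwap (n + 1))).prod := by
  induction l with
  | nil => simp [shiftPerm_one]
  | cons j l ih => simp [shiftPerm_mul, shiftPerm_adjSwap, ih]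

/-- The word `c_n ⋯ c_1` in the generators of `𝔹_{n+1}`. -/
def cycleWord : (n : ℕ) → List (Fin n)
  | 0 => []
  | n + 1 => (cycleWord n).map Fin.succ ++ [0]

theorem length_cycleWord (n : ℕ) : (cycleWord n).length = n := by
  induction n with
  | zero => rfl
  | succ n ih => simp [cycleWord, ih]

theorem prod_cycleWord (n : ℕ) :
    ((cycleWord n).map (adjSwap n)).prod = (finRotate (n + 1))⁻¹ := by
  induction n with
  | zero => exact Subsingleton.elim (α := Equiv.Perm (Fin 1)) _ _
  | succ n ih =>
    rw [cycleWord, List.map_append, List.prod_append, ← shiftPerm_prod, ih, eq_inv_iff_mul_eq_one]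
    ext1 a
    simp only [List.map_cons, List.map_nil, List.prod_singleton, Equiv.Perm.mul_apply,
      Equiv.Perm.one_apply]
    refine Fin.lastCases ?_ (fun a => ?_) a
    · rw [finRotate_last, adjSwap, Fin.castSucc_zero, Equiv.swap_apply_left, shiftPerm_succ]
      rw [← Fin.succ_last, Equiv.Perm.inv_eq_iff_eq.mpr (finRotate_last (n := n)).symm]
    · have h1 : finRotate (n + 2) a.castSucc = a.succ := by
        simp
      rw [h1]
      refine Fin.cases ?_ (fun b => ?_) a
      · rw [adjSwap, Equiv.swap_apply_right]
        simp
      · have h2 : adjSwap (n + 1) 0 b.succ.succ = b.succ.succ := by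
          ext
          rw [adjSwap_val]
          simp
        rw [h2, shiftPerm_succ, ← Fin.succ_castSucc]
        congr 1
        rw [Equiv.Perm.inv_eq_iff_eq]
        simp

theorem inv_succ (π : Equiv.Perm (Fin (n + 1))) :
    inv π = (∑ b : Fin n, if π b.succ < π 0 then 1 else 0) +
      ∑ a : Fin n, ∑ b : Fin n, if a < b ∧ π b.succ < π a.succ then 1 else 0 := by
  simp only [inv_eq_sum, Fin.sum_univ_succ, Fin.succ_lt_succ_iff, Fin.succ_pos, Fin.not_lt_zero,
    false_and, true_and, if_false, zero_add]

theorem inv_shiftPerm (σ : Equiv.Perm (Fin n)) : inv (shiftPerm σ) = inv σ := by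
  simp only [inv_succ, shiftPerm_zero, shiftPerm_succ, Fin.not_lt_zero, if_false,
    Finset.sum_const_zero, zero_add, Fin.succ_lt_succ_iff, inv_eq_sum]

theorem finRotate_inv_zero : (finRotate (n + 1))⁻¹ 0 = Fin.last n := by
  rw [Equiv.Perm.inv_eq_iff_eq, finRotate_last]

theorem finRotate_inv_succ (a : Fin n) : (finRotate (n + 1))⁻¹ a.succ = a.castSucc := by
  rw [Equiv.Perm.inv_eq_iff_eq]
  cases n with
  | zero => exact a.elim0
  | succ n => simp

/-- The rotation sends the initial value 0 to the maximum, creating n inversions, and preserves the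
order of the other values. -/
theorem inv_rotate_mul_shiftPerm (σ : Equiv.Perm (Fin n)) :
    inv ((finRotate (n + 1))⁻¹ * shiftPerm σ) = n + inv σ := by
  simp only [inv_succ, Equiv.Perm.mul_apply, shiftPerm_zero, shiftPerm_succ, finRotate_inv_zero,
    finRotate_inv_succ, Fin.castSucc_lt_last, if_true, Fin.castSucc_lt_castSucc_iff]
  simp [inv_eq_sum]

/-- The homomorphism `𝔹_{n+1} → 𝔹_{n+2}`, `c_j ↦ c_{j+1}`. -/
def shiftBraid (n : ℕ) : BraidGroup n →* BraidGroup (n + 1) :=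
  PresentedGroup.toGroup (f := fun j => braidGen (n + 1) j.succ) (by
    rintro r (⟨i, j, h, rfl⟩ | ⟨i, j, h, rfl⟩)
    · simp only [map_mul, map_inv, FreeGroup.lift_apply_of, mul_inv_eq_one]
      exact braidGen_braid (by simpa using h)
    · simp only [map_mul, map_inv, FreeGroup.lift_apply_of, mul_inv_eq_one]
      exact braidGen_comm (by simp only [Fin.val_succ]; omega))

@[simp] theorem shiftBraid_braidGen (j : Fin n) :
    shiftBraid n (braidGen n j) = braidGen (n + 1) j.succ :=
  PresentedGroup.toGroup.of _

theorem shiftBraid_prod (l : List (Fin n)) : shiftBraid n (l.map (braidGen n)).prod =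
    ((l.map Fin.succ).map (braidGen (n + 1))).prod := by
  simp [map_list_prod, Function.comp_def]

/-- The element `c_n ⋯ c_1` of `𝔹_{n+1}`. -/
def cycleBraid (n : ℕ) : BraidGroup n := ((cycleWord n).map (braidGen n)).prod

theorem cycleBraid_succ (n : ℕ) :
    cycleBraid (n + 1) = shiftBraid n (cycleBraid n) * braidGen (n + 1) 0 := by
  simp [cycleBraid, cycleWord, shiftBraid_prod]

theorem matsumoto_shiftPerm (σ : Equiv.Perm (Fin (n + 1))) :
    matsumoto (n + 1) (shiftPerm σ) = shiftBraid n (matsumoto n σ) := by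
  obtain ⟨l, hl, hlen⟩ := exists_word_length_eq_inv σ
  rw [matsumoto_eq hl hlen, shiftBraid_prod]
  exact matsumoto_eq (by rw [← shiftPerm_prod, hl]) (by rw [inv_shiftPerm, List.length_map, hlen])

/-- The lengths add by `inv_rotate_mul_shiftPerm`, so concatenating reduced words of the two factors
stays reduced. -/
theorem matsumoto_rotate_mul_shiftPerm (σ : Equiv.Perm (Fin (n + 1))) :
    matsumoto (n + 1) ((finRotate (n + 2))⁻¹ * shiftPerm σ) =
      cycleBraid (n + 1) * shiftBraid n (matsumoto n σ) := by
  obtain ⟨l, hl, hlen⟩ := exists_word_length_eq_inv σ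
  rw [matsumoto_eq hl hlen, shiftBraid_prod, cycleBraid, ← List.prod_append, ← List.map_append]
  refine matsumoto_eq ?_ ?_
  · rw [List.map_append, List.prod_append, prod_cycleWord, ← shiftPerm_prod, hl]
  · rw [inv_rotate_mul_shiftPerm, List.length_append, length_cycleWord, List.length_map, hlen]

/-- A new smallest value in front only lengthens the increasing block. -/
theorem shiftPerm_mem_shuffleSet {m : ℕ} {σ : Equiv.Perm (Fin (n + 1))} :
    shiftPerm σ ∈ shuffleSet (n + 1) m ↔ σ ∈ shuffleSet n m := by
  constructor
  · rintro ⟨h0, h1, h2, h3⟩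
    refine ⟨?_, fun a b hab hb => ?_, fun a ha => ?_, fun a b hab hb => ?_⟩
    · by_contra h
      have := h2 0 (by simp; omega)
      rw [shiftPerm_zero] at this
      exact absurd this (Fin.last_pos).ne
    · simpa using h1 a.succ b.succ (by simpa using hab) (by simp only [Fin.val_succ]; omega)
    · simpa [← Fin.succ_last] using h2 a.succ (by simp only [Fin.val_succ]; omega)
    · simpa using h3 a.succ b.succ (by simpa using hab) (by simp only [Fin.val_succ]; omega)
  · rintro ⟨h0, h1, h2, h3⟩
    refine ⟨by omega, fun a b hab hb => ?_, fun a ha => ?_, fun a b hab hb => ?_⟩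
    · obtain ⟨b, rfl⟩ := Fin.exists_succ_eq.mpr (Fin.ne_zero_of_lt hab)
      rcases Fin.eq_zero_or_eq_succ a with rfl | ⟨a, rfl⟩
      · simp
      · simpa using h1 a b (by simpa using hab) (by simp only [Fin.val_succ] at hb; omega)
    · rcases Fin.eq_zero_or_eq_succ a with rfl | ⟨a, rfl⟩
      · simp at ha; omega
      · simpa [← Fin.succ_last] using h2 a (by simp only [Fin.val_succ] at ha; omega)
    · obtain ⟨b, rfl⟩ := Fin.exists_succ_eq.mpr (Fin.ne_zero_of_lt hab)
      rcases Fin.eq_zero_or_eq_succ a with rfl | ⟨a, rfl⟩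
      · simp at hb; omega
      · simpa using h3 a b (by simpa using hab) (by simp only [Fin.val_succ] at hb; omega)

theorem shiftPerm_mul_rotate_castSucc (σ : Equiv.Perm (Fin (n + 1))) (a : Fin (n + 1)) :
    (shiftPerm σ * finRotate (n + 2)) a.castSucc = (σ a).succ := by
  simp

theorem shiftPerm_mul_rotate_last (σ : Equiv.Perm (Fin (n + 1))) :
    (shiftPerm σ * finRotate (n + 2)) (Fin.last _) = 0 := by
  simp

/-- A new smallest value at the end only lengthens the decreasing block, hence the step from m to m
+ 1. -/
theorem shiftPerm_mul_rotate_mem_shuffleSet {m : ℕ} {σ : Equiv.Perm (Fin (n + 1))} :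
    shiftPerm σ * finRotate (n + 2) ∈ shuffleSet (n + 1) (m + 1) ↔ σ ∈ shuffleSet n m := by
  constructor
  · rintro ⟨h0, h1, h2, h3⟩
    refine ⟨by omega, fun a b hab hb => ?_, fun a ha => ?_, fun a b hab hb => ?_⟩
    · have := h1 a.castSucc b.castSucc (by simpa using hab) (by simp only [Fin.val_castSucc]; omega)
      rwa [shiftPerm_mul_rotate_castSucc, shiftPerm_mul_rotate_castSucc, Fin.succ_lt_succ_iff]
        at this
    · have := h2 a.castSucc (by simp only [Fin.val_castSucc]; omega)
      rwa [shiftPerm_mul_rotate_castSucc, ← Fin.succ_last, Fin.succ_inj] at this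
    · have := h3 a.castSucc b.castSucc (by simpa using hab) (by simp only [Fin.val_castSucc]; omega)
      rwa [shiftPerm_mul_rotate_castSucc, shiftPerm_mul_rotate_castSucc, Fin.succ_lt_succ_iff]
        at this
  · rintro ⟨h0, h1, h2, h3⟩
    refine ⟨by omega, fun a b hab hb => ?_, fun a ha => ?_, fun a b hab hb => ?_⟩
    · obtain ⟨a, rfl⟩ := Fin.exists_castSucc_eq.mpr (Fin.ne_last_of_lt hab)
      rcases Fin.eq_castSucc_or_eq_last b with ⟨b, rfl⟩ | rfl
      · rw [shiftPerm_mul_rotate_castSucc, shiftPerm_mul_rotate_castSucc, Fin.succ_lt_succ_iff]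
        exact h1 a b (by simpa using hab) (by simp only [Fin.val_castSucc] at hb; omega)
      · simp at hb; omega
    · rcases Fin.eq_castSucc_or_eq_last a with ⟨a, rfl⟩ | rfl
      · rw [shiftPerm_mul_rotate_castSucc, ← Fin.succ_last, Fin.succ_inj]
        exact h2 a (by simp only [Fin.val_castSucc] at ha; omega)
      · simp at ha
    · obtain ⟨a, rfl⟩ := Fin.exists_castSucc_eq.mpr (Fin.ne_last_of_lt hab)
      rcases Fin.eq_castSucc_or_eq_last b with ⟨b, rfl⟩ | rfl
      · rw [shiftPerm_mul_rotate_castSucc, shiftPerm_mul_rotate_castSucc, Fin.succ_lt_succ_iff]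
        exact h3 a b (by simpa using hab) (by simp only [Fin.val_castSucc] at hb; omega)
      · rw [shiftPerm_mul_rotate_castSucc, shiftPerm_mul_rotate_last]
        exact Fin.succ_pos _

/-- The smallest value can only start the increasing block or finish the decreasing one, and the
latter is empty for m = 0. It cannot sit at the peak, which carries the maximum. -/
theorem eq_zero_or_last_of_mem_shuffleSet {m : ℕ} {π : Equiv.Perm (Fin (n + 2))}
    (h : π ∈ shuffleSet (n + 1) m) : π 0 = 0 ∨ (π (Fin.last _) = 0 ∧ m ≠ 0) := by
  obtain ⟨h0, h1, h2, h3⟩ := h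
  obtain ⟨p, hp⟩ := π.surjective 0
  by_cases hp0 : p = 0
  · exact Or.inl (hp0 ▸ hp)
  have hpos : 0 < p := Fin.pos_iff_ne_zero.mpr hp0
  right
  rcases lt_trichotomy ((p : ℕ) + m) (n + 1) with hlt | heq | hgt
  · have := h1 0 p hpos hlt
    rw [hp] at this
    exact absurd this (Fin.not_lt_zero _)
  · have := h2 p heq
    rw [hp] at this
    exact absurd this (Fin.last_pos).ne
  · rcases (Fin.le_last p).eq_or_lt with rfl | hlt
    · refine ⟨hp, ?_⟩
      rintro rfl
      simp at hgt
    · have := h3 p _ hlt hgt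
      rw [hp] at this
      exact absurd this (Fin.not_lt_zero _)

variable (k : Type*) [Field k]

/-- The homomorphism `𝕜𝔹_{n+1} → 𝕜𝔹_{n+2}`, `c_j ↦ c_{j+1}`. -/
def shiftAlg (n : ℕ) : MonoidAlgebra k (BraidGroup n) →ₐ[k] MonoidAlgebra k (BraidGroup (n + 1)) :=
  MonoidAlgebra.mapDomainAlgHom k k (shiftBraid n)

theorem shiftAlg_of (b : BraidGroup n) : shiftAlg k n (MonoidAlgebra.of k _ b) =
    MonoidAlgebra.of k _ (shiftBraid n b) := by
  simp [shiftAlg]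

theorem exists_of_rotate {π : Equiv.Perm (Fin (n + 2))} (h : π (Fin.last _) = 0) :
    ∃ σ, shiftPerm σ * finRotate (n + 2) = π := by
  obtain ⟨σ, hσ⟩ := exists_shiftPerm (π := π * (finRotate (n + 2))⁻¹) (by
    rw [Equiv.Perm.mul_apply, finRotate_inv_zero, h])
  exact ⟨σ, by rw [hσ, inv_mul_cancel_right]⟩

theorem gElem_zero_zero : gElem k 0 0 = 1 := by
  classical
  have : Subsingleton (Fin (0 + 1)) := inferInstanceAs (Subsingleton (Fin 1))
  have h1 : ∀ π : Equiv.Perm (Fin (0 + 1)), π ∈ shuffleSet 0 0 := fun π =>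
    ⟨le_rfl, fun a b hab _ => absurd hab (by simp [Subsingleton.elim a b]),
      fun a _ => Subsingleton.elim _ _,
      fun a b hab _ => absurd hab (by simp [Subsingleton.elim a b])⟩
  rw [gElem, Finset.filter_true_of_mem (fun π _ => h1 π), Fintype.sum_subsingleton _ 1,
    matsumoto_eq (l := []) (by simp) (by simp)]
  simp [MonoidAlgebra.one_def]

theorem gElem_eq_zero {m : ℕ} (h : n < m) : gElem k n m = 0 := by
  classical
  rw [gElem, Finset.filter_false_of_mem, Finset.sum_empty]
  exact fun π _ hπ => absurd hπ.1 (by omega)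

theorem gElem_succ_zero : gElem k (n + 1) 0 = shiftAlg k n (gElem k n 0) := by
  classical
  rw [gElem, gElem, map_sum]
  symm
  refine Finset.sum_bij (fun σ _ => shiftPerm σ) ?_ (fun σ _ τ _ h => shiftPerm_injective h) ?_ ?_
  · intro σ hσ
    simpa [shiftPerm_mem_shuffleSet] using hσ
  · intro π hπ
    simp only [Finset.mem_filter, Finset.mem_univ, true_and] at hπ
    rcases eq_zero_or_last_of_mem_shuffleSet hπ with h | h
    · obtain ⟨σ, rfl⟩ := exists_shiftPerm h
      exact ⟨σ, by simpa [shiftPerm_mem_shuffleSet] using hπ, rfl⟩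
    · exact absurd rfl h.2
  · intro σ _
    rw [shiftAlg_of, shiftPerm_inv, matsumoto_shiftPerm]

/-- The two summands collect the permutations with smallest value first and last. Since g sums over
c_{π⁻¹}, the rotation on the right of π appears as its inverse on the left, which is the cycle
c_{n+1}⋯c_1. -/
theorem gElem_succ_succ (m : ℕ) : gElem k (n + 1) (m + 1) = shiftAlg k n (gElem k n (m + 1)) +
    MonoidAlgebra.of k _ (cycleBraid (n + 1)) * shiftAlg k n (gElem k n m) := by
  classical
  have hset : (Finset.univ.filter fun π : Equiv.Perm (Fin (n + 2)) =>
      π ∈ shuffleSet (n + 1) (m + 1)) =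
      (Finset.univ.filter fun σ : Equiv.Perm (Fin (n + 1)) => σ ∈ shuffleSet n (m + 1)).image
        shiftPerm ∪
      (Finset.univ.filter fun σ : Equiv.Perm (Fin (n + 1)) => σ ∈ shuffleSet n m).image
        (fun σ => shiftPerm σ * finRotate (n + 2)) := by
    ext π
    simp only [Finset.mem_filter, Finset.mem_univ, true_and, Finset.mem_union, Finset.mem_image]
    constructor
    · intro hπ
      rcases eq_zero_or_last_of_mem_shuffleSet hπ with h | ⟨h, -⟩
      · obtain ⟨σ, rfl⟩ := exists_shiftPerm h
        exact Or.inl ⟨σ, shiftPerm_mem_shuffleSet.mp hπ, rfl⟩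
      · obtain ⟨σ, rfl⟩ := exists_of_rotate h
        exact Or.inr ⟨σ, shiftPerm_mul_rotate_mem_shuffleSet.mp hπ, rfl⟩
    · rintro (⟨σ, hσ, rfl⟩ | ⟨σ, hσ, rfl⟩)
      · exact shiftPerm_mem_shuffleSet.mpr hσ
      · exact shiftPerm_mul_rotate_mem_shuffleSet.mpr hσ
  have hdisj : Disjoint
      ((Finset.univ.filter fun σ : Equiv.Perm (Fin (n + 1)) => σ ∈ shuffleSet n (m + 1)).image
        shiftPerm)
      ((Finset.univ.filter fun σ : Equiv.Perm (Fin (n + 1)) => σ ∈ shuffleSet n m).image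
        (fun σ => shiftPerm σ * finRotate (n + 2))) := by
    rw [Finset.disjoint_left]
    simp only [Finset.mem_image, not_exists, not_and]
    rintro _ ⟨σ, -, rfl⟩ τ - h
    have := congrArg (fun π : Equiv.Perm (Fin (n + 2)) => π 0) h
    rw [← Fin.castSucc_zero] at this
    simp only [shiftPerm_mul_rotate_castSucc] at this
    simp at this
  rw [gElem, gElem, gElem, hset, Finset.sum_union hdisj,
    Finset.sum_image fun σ _ τ _ h => shiftPerm_injective h,
    Finset.sum_image fun σ _ τ _ h => shiftPerm_injective (mul_right_cancel h), map_sum, map_sum,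
    Finset.mul_sum]
  congr 1
  · refine Finset.sum_congr rfl fun σ _ => ?_
    rw [shiftAlg_of, shiftPerm_inv, matsumoto_shiftPerm]
  · refine Finset.sum_congr rfl fun σ _ => ?_
    rw [shiftAlg_of, mul_inv_rev, shiftPerm_inv, matsumoto_rotate_mul_shiftPerm, map_mul]

end ShuffleRecursion

/-! ### Closure properties of `H`-linear maps -/

section ActLinear

variable {k H : Type*} [Field k] [Ring H] [HopfAlgebra k H]
variable {V W Z V' W' : Type*} [AddCommGroup V] [Module k V] [AddCommGroup W] [Module k W]
  [AddCommGroup Z] [Module k Z] [AddCommGroup V'] [Module k V'] [AddCommGroup W'] [Module k W']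

/-- `f` commutes with the actions of `H`. -/
abbrev IsActLinear (X : ActCoact k H V) (Y : ActCoact k H W) (f : V →ₗ[k] W) : Prop :=
  f ∘ₗ X.act = Y.act ∘ₗ f.lTensor H

theorem IsActLinear.id (X : ActCoact k H V) : IsActLinear X X LinearMap.id := by
  simp [IsActLinear]

theorem IsActLinear.comp {X : ActCoact k H V} {Y : ActCoact k H W} {Z' : ActCoact k H Z}
    {g : W →ₗ[k] Z} {f : V →ₗ[k] W} (hg : IsActLinear Y Z' g) (hf : IsActLinear X Y f) :
    IsActLinear X Z' (g ∘ₗ f) := by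
  rw [IsActLinear, LinearMap.comp_assoc, hf, ← LinearMap.comp_assoc, hg, LinearMap.comp_assoc,
    LinearMap.lTensor_comp]

theorem IsActLinear.smul {X : ActCoact k H V} {Y : ActCoact k H W} {f : V →ₗ[k] W}
    (hf : IsActLinear X Y f) (r : k) : IsActLinear X Y (r • f) := by
  rw [IsActLinear, LinearMap.lTensor_smul, LinearMap.comp_smul, LinearMap.smul_comp, hf]

theorem IsActLinear.sum {X : ActCoact k H V} {Y : ActCoact k H W} {ι : Type*} (s : Finset ι)
    {f : ι → V →ₗ[k] W} (hf : ∀ i ∈ s, IsActLinear X Y (f i)) :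
    IsActLinear X Y (∑ i ∈ s, f i) := by
  classical
  induction s using Finset.induction_on with
  | empty => simp [IsActLinear]
  | insert a s ha ih =>
    have h1 := ih fun i hi => hf i (Finset.mem_insert_of_mem hi)
    have h2 := hf a (Finset.mem_insert_self _ _)
    rw [Finset.sum_insert ha, IsActLinear, LinearMap.lTensor_add, LinearMap.comp_add,
      LinearMap.add_comp, h1, h2]

theorem IsActLinear.map {X : ActCoact k H V} {X' : ActCoact k H V'}
    {Y : ActCoact k H W} {Y' : ActCoact k H W'} {f : V →ₗ[k] V'} {g : W →ₗ[k] W'}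
    (hf : IsActLinear X X' f) (hg : IsActLinear Y Y' g) :
    IsActLinear (X.tensor Y) (X'.tensor Y') (TensorProduct.map f g) := by
  refine TensorProduct.ext' fun h t => ?_
  induction t using TensorProduct.induction_on with
  | zero => simp
  | add a b ha hb => simp only [TensorProduct.tmul_add, map_add, ha, hb]
  | tmul v w =>
    have h1 := LinearMap.congr_fun (ActCoact.orbit_tensor X Y v w) h
    have h2 := LinearMap.congr_fun (ActCoact.orbit_tensor X' Y' (f v) (g w)) h
    rw [ActCoact.orbit_apply] at h1 h2
    rw [LinearMap.comp_apply, LinearMap.comp_apply, LinearMap.lTensor_tmul,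
      TensorProduct.map_tmul, h1, h2, LinearMap.comp_apply, LinearMap.comp_apply,
      TensorProduct.map_map, ActCoact.orbit_map hf, ActCoact.orbit_map hg]

end ActLinear

/-! ### Primitive elements in a braided Hopf algebra and the operators G_m -/

section BraidedHopf

variable {k H Q : Type*} [Field k] [Ring H] [HopfAlgebra k H] [Ring Q] [Algebra k Q]
  {X : ActCoact k H Q}

variable (X) in
/-- The product twisted by the braiding, `x ⊗ q ↦ μ(c(x ⊗ q)) = (x₍₋₁₎ · q) x₍₀₎`. -/
def twist : Q →ₗ[k] Q →ₗ[k] Q :=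
  (TensorProduct.mk k Q Q).compr₂ (LinearMap.mul' k Q ∘ₗ braiding X X)

theorem twist_apply (x q : Q) : twist X x q = LinearMap.mul' k Q (braiding X X (x ⊗ₜ q)) := rfl

theorem twist_map {F : Q →ₗ[k] Q} (hF : IsActLinear X X F) (x q : Q) :
    twist X x (F q) = LinearMap.mul' k Q (F.rTensor Q (braiding X X (x ⊗ₜ q))) := by
  rw [twist_apply, braiding_natural_right X hF]

variable (X) in
/-- `a ⊗ b ↦ (id ⊗ μ)(c(x ⊗ a) ⊗ b)`. -/
def twistMul (x : Q) : Q ⊗[k] Q →ₗ[k] Q ⊗[k] Q :=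
  (LinearMap.mul' k Q).lTensor Q ∘ₗ (TensorProduct.assoc k Q Q Q).toLinearMap ∘ₗ
    (braiding X X ∘ₗ TensorProduct.mk k Q Q x).rTensor Q

theorem twistMul_tmul (x a b : Q) : twistMul X x (a ⊗ₜ b) =
    (LinearMap.mulRight k b).lTensor Q (braiding X X (x ⊗ₜ a)) := by
  simp only [twistMul, LinearMap.comp_apply, LinearMap.rTensor_tmul, TensorProduct.mk_apply,
    LinearEquiv.coe_coe]
  induction braiding X X (x ⊗ₜ[k] a) using TensorProduct.induction_on with
  | zero => simp
  | add c d hc hd => simp only [TensorProduct.add_tmul, map_add, hc, hd]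
  | tmul c d => simp

/-- Moving x past a may alter x, but its new value stays in `N`; identities known only for elements
of `N` can therefore be applied to the second leg. -/
theorem exists_braiding_eq {N : Submodule k Q} (hN : X.IsSub N) {x : Q} (hx : x ∈ N) (a : Q) :
    ∃ t : Q ⊗[k] N, N.subtype.lTensor Q t = braiding X X (x ⊗ₜ a) := by
  obtain ⟨t, ht⟩ := braiding_mem (X := X) (Y := X) (A := ⊤) (B := N) (fun _ _ _ => trivial)
    hN.coact_mem hx (a := a) trivial
  refine ⟨(⊤ : Submodule k Q).subtype.rTensor N t, ?_⟩
  rw [← ht, LinearMap.lTensor, LinearMap.rTensor, TensorProduct.map_map]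
  rfl

variable [Coalgebra k Q] {S : Q →ₗ[k] Q}

/-- Multiplication is a morphism of 𝒞, so by the hexagon x passes a product by passing a and then b.
-/
theorem twist_mul (hB : IsBraidedHopfAlgebra X S) (x a b : Q) :
    twist X x (a * b) =
      LinearMap.mul' k Q (((twist X).flip b).lTensor Q (braiding X X (x ⊗ₜ a))) := by
  have h1 := braiding_natural_right X hB.mul_hom.map_act x (a ⊗ₜ b)
  have h2 := LinearMap.congr_fun (braiding_tensor hB.isYetterDrinfeld.toIsModComod X X)
    (x ⊗ₜ (a ⊗ₜ b))
  simp only [LinearMap.comp_apply, LinearEquiv.coe_coe, TensorProduct.assoc_symm_tmul,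
    LinearMap.rTensor_tmul] at h2
  rw [← LinearEquiv.eq_symm_apply] at h2
  rw [twist_apply, ← LinearMap.mul'_apply (R := k), h1, h2]
  induction braiding X X (x ⊗ₜ[k] a) using TensorProduct.induction_on with
  | zero => simp
  | add c d hc hd => simp only [TensorProduct.add_tmul, map_add, hc, hd]
  | tmul c d =>
    simp only [TensorProduct.assoc_tmul, LinearMap.lTensor_tmul, LinearMap.flip_apply,
      twist_apply, LinearMap.mul'_apply]
    induction braiding X X (d ⊗ₜ[k] b) using TensorProduct.induction_on with
    | zero => simp
    | add c d hc hd => simp only [TensorProduct.tmul_add, map_add, mul_add, hc, hd]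
    | tmul e f => simp [mul_assoc]

theorem IsBraidedHopfAlgebra.coact_one (hB : IsBraidedHopfAlgebra X S) :
    X.coact 1 = 1 ⊗ₜ 1 := by
  have := LinearMap.congr_fun hB.unit_hom.map_coact 1
  simpa [unitObj] using this

theorem IsBraidedHopfAlgebra.act_one (hB : IsBraidedHopfAlgebra X S) (h : H) :
    X.act (h ⊗ₜ 1) = Coalgebra.counit (R := k) h • (1 : Q) := by
  have := LinearMap.congr_fun hB.unit_hom.map_act (h ⊗ₜ 1)
  simpa [unitObj, Algebra.algebraMap_eq_smul_one] using this.symm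

theorem braiding_one_left {V : Type*} [AddCommGroup V] [Module k V]
    (hB : IsBraidedHopfAlgebra X S) {Y : ActCoact k H V} (hY : Y.IsModComod) (v : V) :
    braiding X Y (1 ⊗ₜ v) = v ⊗ₜ 1 := by
  rw [braiding_tmul, hB.coact_one]
  simp [hY.one_act]

theorem braiding_one_right {V : Type*} [AddCommGroup V] [Module k V]
    (hB : IsBraidedHopfAlgebra X S) {Y : ActCoact k H V} (hY : Y.IsModComod) (v : V) :
    braiding Y X (v ⊗ₜ 1) = 1 ⊗ₜ v := by
  have hcu := LinearMap.congr_fun hY.counit_coact v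
  simp only [LinearMap.comp_apply, LinearEquiv.coe_coe, LinearMap.id_apply] at hcu
  rw [braiding_tmul]
  conv_rhs => rw [← hcu]
  induction Y.coact v using TensorProduct.induction_on with
  | zero => simp
  | add a b ha hb => simp only [TensorProduct.tmul_add, map_add, ha, hb]
  | tmul a b => simp [hB.act_one, TensorProduct.smul_tmul]

theorem twist_one (hB : IsBraidedHopfAlgebra X S) (x : Q) : twist X x 1 = x := by
  rw [twist_apply, braiding_one_right hB hB.isYetterDrinfeld.toIsModComod]
  simp

/-- In Δ(x)Δ(y) the summand x ⊗ 1 contributes no braiding, since 1 braids trivially, whereas 1 ⊗ x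
must cross the first leg of Δ(y). -/
theorem comul_mul_of_primitive (hB : IsBraidedHopfAlgebra X S) {x : Q}
    (hx : Coalgebra.comul (R := k) x = x ⊗ₜ[k] 1 + 1 ⊗ₜ[k] x) (y : Q) :
    Coalgebra.comul (R := k) (x * y) =
      (LinearMap.mulLeft k x).rTensor Q (Coalgebra.comul y) +
        twistMul X x (Coalgebra.comul y) := by
  have h := LinearMap.congr_fun hB.comul_mul (x ⊗ₜ y)
  simp only [LinearMap.comp_apply, LinearMap.mul'_apply, TensorProduct.map_tmul, hx] at h
  rw [h]
  induction Coalgebra.comul (R := k) y using TensorProduct.induction_on with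
  | zero => simp
  | add c d hc hd =>
    simp only [TensorProduct.tmul_add, map_add] at hc hd ⊢
    rw [hc, hd]
    abel
  | tmul a b =>
    simp only [middle, TensorProduct.add_tmul, map_add, LinearMap.comp_apply, LinearEquiv.coe_coe,
      TensorProduct.assoc_tmul, TensorProduct.assoc_symm_tmul, LinearMap.lTensor_tmul,
      LinearMap.rTensor_tmul, braiding_one_left hB hB.isYetterDrinfeld.toIsModComod,
      TensorProduct.map_tmul, LinearMap.mul'_apply, one_mul, LinearMap.mulLeft_apply,
      twistMul_tmul, add_right_inj]
    induction braiding X X (x ⊗ₜ[k] a) using TensorProduct.induction_on with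
    | zero => simp
    | add c d hc hd => simp only [TensorProduct.add_tmul, TensorProduct.tmul_add, map_add, hc, hd]
    | tmul c d => simp

theorem counit_of_primitive (hB : IsBraidedHopfAlgebra X S) {x : Q}
    (hx : Coalgebra.comul (R := k) x = x ⊗ₜ[k] 1 + 1 ⊗ₜ[k] x) :
    Coalgebra.counit (R := k) x = 0 := by
  have h := Coalgebra.rTensor_counit_comul (R := k) x
  rw [hx] at h
  have h2 := congrArg (Coalgebra.counit (R := k) ∘ₗ (TensorProduct.lid k Q).toLinearMap) h
  simpa [hB.counit_one] using h2

/-- The sum `A` of S(x ·) and twist_x ∘ S satisfies A * id = 0 under convolution, because ε(xy) = 0.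
As id has convolution inverse S, it follows that A = 0. -/
theorem antipode_mul_of_primitive (hB : IsBraidedHopfAlgebra X S) {x : Q}
    (hx : Coalgebra.comul (R := k) x = x ⊗ₜ[k] 1 + 1 ⊗ₜ[k] x) (y : Q) :
    S (x * y) = - twist X x (S y) := by
  let A : Q →ₗ[k] Q := S ∘ₗ LinearMap.mulLeft k x + twist X x ∘ₗ S
  have h1 : ∀ t : Q ⊗[k] Q, LinearMap.mul' k Q (S.rTensor Q (twistMul X x t)) =
      LinearMap.mul' k Q ((twist X x ∘ₗ S).rTensor Q t) := by
    intro t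
    induction t using TensorProduct.induction_on with
    | zero => simp
    | add c d hc hd => simp only [map_add, hc, hd]
    | tmul a b =>
      rw [twistMul_tmul, LinearMap.rTensor_tmul, LinearMap.comp_apply,
        twist_map hB.antipode_hom.map_act, LinearMap.mul'_apply]
      induction braiding X X (x ⊗ₜ[k] a) using TensorProduct.induction_on with
      | zero => simp
      | add c d hc hd => simp only [map_add, add_mul, hc, hd]
      | tmul c d => simp [mul_assoc]
  have h2 : ∀ y, LinearMap.mul' k Q (A.rTensor Q (Coalgebra.comul y)) = 0 := by
    intro y
    have h := LinearMap.congr_fun hB.mul_antipode_left (x * y)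
    simp only [LinearMap.comp_apply, hB.counit_mul, counit_of_primitive hB hx, zero_mul, map_zero,
      comul_mul_of_primitive hB hx, map_add, h1] at h
    rw [← h, LinearMap.rTensor_add, LinearMap.add_apply, map_add, LinearMap.rTensor_comp_apply]
  have h3 : WithConv.toConv A * WithConv.toConv (LinearMap.id : Q →ₗ[k] Q) = 0 := by
    ext y
    exact h2 y
  have h4 : WithConv.toConv (LinearMap.id : Q →ₗ[k] Q) * WithConv.toConv S = 1 := by
    ext y
    exact LinearMap.congr_fun hB.mul_antipode_right y
  have h5 : WithConv.toConv A = 0 := by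
    rw [← mul_one (WithConv.toConv A), ← h4, ← mul_assoc, h3, zero_mul]
  have h6 : A y = 0 := congrArg (fun f => f.ofConv y) h5
  simp only [A, LinearMap.add_apply, LinearMap.comp_apply, LinearMap.mulLeft_apply] at h6
  exact eq_neg_of_add_eq_zero_left h6

theorem antipode_one_eq (hB : IsBraidedHopfAlgebra X S) : S 1 = 1 := by
  have := LinearMap.congr_fun hB.mul_antipode_left 1
  simpa [hB.comul_one, hB.counit_one] using this

/-- `N` consists of primitive elements and `τ m` behaves like the projection onto the component of
degree `m` for a grading in which `N` has degree `1`. -/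
structure IsPrimitiveGrading (X : ActCoact k H Q) (N : Submodule k Q) (τ : ℕ → Q →ₗ[k] Q) :
    Prop where
  isSub : X.IsSub N
  primitive : ∀ x ∈ N, Coalgebra.comul (R := k) x = x ⊗ₜ[k] 1 + 1 ⊗ₜ[k] x
  act : ∀ m, IsActLinear X X (τ m)
  zero_apply : ∀ q, τ 0 q = Coalgebra.counit (R := k) q • (1 : Q)
  zero_mul : ∀ x ∈ N, ∀ q, τ 0 (x * q) = 0
  succ_mul : ∀ x ∈ N, ∀ m q, τ (m + 1) (x * q) = x * τ m q
  succ_one : ∀ m, τ (m + 1) 1 = 0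

/-- The convolution product of the identity and `S ∘ τ`. -/
def idConv (S τ : Q →ₗ[k] Q) : Q →ₗ[k] Q :=
  LinearMap.mul' k Q ∘ₗ (S ∘ₗ τ).lTensor Q ∘ₗ Coalgebra.comul

variable {N : Submodule k Q} {τ : ℕ → Q →ₗ[k] Q}

theorem idConv_mul_aux (hB : IsBraidedHopfAlgebra X S) {x : Q}
    (hx : Coalgebra.comul (R := k) x = x ⊗ₜ[k] 1 + 1 ⊗ₜ[k] x) (τ : Q →ₗ[k] Q) (y : Q) :
    idConv S τ (x * y) = x * idConv S τ y +
      LinearMap.mul' k Q ((S ∘ₗ τ).lTensor Q (twistMul X x (Coalgebra.comul y))) := by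
  simp only [idConv, LinearMap.comp_apply (R₁ := k), comul_mul_of_primitive hB hx, map_add]
  congr 1
  induction Coalgebra.comul (R := k) y using TensorProduct.induction_on with
  | zero => simp
  | add c d hc hd => simp only [map_add, mul_add, hc, hd]
  | tmul a b => simp [mul_assoc]

/-- In the twisted part of Δ(xy) the second leg starts with a factor from `N`, so τ_0 kills it. -/
theorem idConv_zero_mul (hB : IsBraidedHopfAlgebra X S) (hN : IsPrimitiveGrading X N τ) {x : Q}
    (hx : x ∈ N) (y : Q) : idConv S (τ 0) (x * y) = x * idConv S (τ 0) y := by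
  rw [idConv_mul_aux hB (hN.primitive x hx), add_eq_left]
  induction Coalgebra.comul (R := k) y using TensorProduct.induction_on with
  | zero => simp
  | add c d hc hd => simp only [map_add, hc, hd, add_zero]
  | tmul a b =>
    rw [twistMul_tmul]
    obtain ⟨t, ht⟩ := exists_braiding_eq hN.isSub hx a
    rw [← ht]
    clear ht
    induction t using TensorProduct.induction_on with
    | zero => simp
    | add c d hc hd => simp only [map_add, hc, hd, add_zero]
    | tmul c d => simp [hN.zero_mul]

/-- In the twisted part of Δ(xy) the second leg is d b with d in `N`. There τ_{m+1}(d b) = d τ_m(b),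
the antipode turns this into -twist_d(S(τ_m(b))), and `twist_mul` reassembles the two legs. -/
theorem idConv_succ_mul (hB : IsBraidedHopfAlgebra X S) (hN : IsPrimitiveGrading X N τ) {x : Q}
    (hx : x ∈ N) (m : ℕ) (y : Q) : idConv S (τ (m + 1)) (x * y) =
      x * idConv S (τ (m + 1)) y - twist X x (idConv S (τ m) y) := by
  rw [idConv_mul_aux hB (hN.primitive x hx), sub_eq_add_neg]
  congr 1
  simp only [idConv, LinearMap.comp_apply]
  induction Coalgebra.comul (R := k) y using TensorProduct.induction_on with
  | zero => simp
  | add c d hc hd => simp only [map_add, hc, hd, neg_add]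
  | tmul a b =>
    rw [twistMul_tmul, LinearMap.lTensor_tmul, LinearMap.mul'_apply, twist_mul hB]
    obtain ⟨t, ht⟩ := exists_braiding_eq hN.isSub hx a
    rw [← ht]
    clear ht
    induction t using TensorProduct.induction_on with
    | zero => simp
    | add c d hc hd => simp only [map_add, hc, hd, neg_add]
    | tmul c d =>
      simp [hN.succ_mul, antipode_mul_of_primitive hB (hN.primitive d d.2)]

theorem idConv_zero (hB : IsBraidedHopfAlgebra X S) (hN : IsPrimitiveGrading X N τ) (q : Q) :
    idConv S (τ 0) q = q := by
  have h := congrArg (TensorProduct.rid k Q) (Coalgebra.lTensor_counit_comul (R := k) q)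
  rw [TensorProduct.rid_tmul, one_smul] at h
  conv_rhs => rw [← h]
  simp only [idConv, LinearMap.comp_apply]
  induction Coalgebra.comul (R := k) q using TensorProduct.induction_on with
  | zero => simp
  | add c d hc hd => simp only [map_add, hc, hd]
  | tmul c d => simp [hN.zero_apply, antipode_one_eq hB]

theorem idConv_succ_one (hB : IsBraidedHopfAlgebra X S) (hN : IsPrimitiveGrading X N τ) (m : ℕ) :
    idConv S (τ (m + 1)) 1 = 0 := by
  simp [idConv, hB.comul_one, hN.succ_one]

theorem isActLinear_idConv (hB : IsBraidedHopfAlgebra X S) (hN : IsPrimitiveGrading X N τ)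
    (m : ℕ) : IsActLinear X X (idConv S (τ m)) :=
  IsActLinear.comp hB.mul_hom.map_act (((IsActLinear.id X).map
    (IsActLinear.comp hB.antipode_hom.map_act (hN.act m))).comp hB.comul_hom.map_act)

/-- The endomorphisms of `Q` that the shuffle elements induce on the powers of `N`. -/
def shuffleEnd (S : Q →ₗ[k] Q) (τ : ℕ → Q →ₗ[k] Q) (m : ℕ) : Q →ₗ[k] Q :=
  (-1 : k) ^ m • ∑ b ∈ Finset.range (m + 1), idConv S (τ b)

theorem shuffleEnd_zero (hB : IsBraidedHopfAlgebra X S) (hN : IsPrimitiveGrading X N τ) (q : Q) :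
    shuffleEnd S τ 0 q = q := by
  simp [shuffleEnd, idConv_zero hB hN]

/-- Summing `idConv_succ_mul` over b ≤ m + 1, the twisted terms are those of G_m because b = 0
contributes none; the factor (-1)^m turns their minus sign into a plus. -/
theorem shuffleEnd_succ_mul (hB : IsBraidedHopfAlgebra X S) (hN : IsPrimitiveGrading X N τ)
    {x : Q} (hx : x ∈ N) (m : ℕ) (y : Q) : shuffleEnd S τ (m + 1) (x * y) =
      x * shuffleEnd S τ (m + 1) y + twist X x (shuffleEnd S τ m y) := by
  simp only [shuffleEnd, LinearMap.smul_apply, LinearMap.sum_apply]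
  rw [Finset.sum_range_succ', Finset.sum_range_succ' _ (m + 1)]
  simp only [idConv_succ_mul hB hN hx, idConv_zero_mul hB hN hx, Finset.sum_sub_distrib, map_smul,
    map_sum, mul_smul_comm, mul_add, Finset.mul_sum, pow_succ]
  module

theorem shuffleEnd_one (hB : IsBraidedHopfAlgebra X S) (hN : IsPrimitiveGrading X N τ) (m : ℕ) :
    shuffleEnd S τ m 1 = (-1 : k) ^ m • (1 : Q) := by
  simp [shuffleEnd, Finset.sum_range_succ', idConv_succ_one hB hN, idConv_zero hB hN]

theorem isActLinear_shuffleEnd (hB : IsBraidedHopfAlgebra X S) (hN : IsPrimitiveGrading X N τ)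
    (m : ℕ) : IsActLinear X X (shuffleEnd S τ m) :=
  (IsActLinear.sum _ fun b _ => isActLinear_idConv hB hN b).smul _

theorem shuffleEnd_eq_zero (hB : IsBraidedHopfAlgebra X S) (hN : IsPrimitiveGrading X N τ)
    (n : ℕ) : ∀ m, n < m → ∀ q ∈ N ^ (n + 1), shuffleEnd S τ m q = 0 := by
  induction n with
  | zero =>
    intro m hm q hq
    obtain ⟨m, rfl⟩ := Nat.exists_eq_succ_of_ne_zero hm.ne'
    rw [zero_add, pow_one] at hq
    -- Recursion at q · 1: the values (-1)^{m+1} and (-1)^m of G_{m+1} and G_m at 1 make the two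
    -- terms cancel.
    rw [← mul_one q, Nat.succ_eq_add_one, shuffleEnd_succ_mul hB hN hq, shuffleEnd_one hB hN,
      shuffleEnd_one hB hN, map_smul, twist_one hB, mul_smul_comm, mul_one, pow_succ]
    module
  | succ n ih =>
    intro m hm q hq
    obtain ⟨m, rfl⟩ := Nat.exists_eq_succ_of_ne_zero (Nat.ne_zero_of_lt hm)
    rw [pow_succ'] at hq
    induction hq using Submodule.mul_induction_on' with
    | mem_mul_mem x hx y hy =>
      rw [Nat.succ_eq_add_one, shuffleEnd_succ_mul hB hN hx, ih _ (by omega) y hy,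
        ih _ (by omega) y hy, mul_zero, map_zero, add_zero]
    | add a _ b _ ha hb => rw [map_add, ha, hb, add_zero]

end BraidedHopf

/-! ### Projections onto homogeneous components -/

section InternalProj

variable {k V I : Type*} [Field k] [AddCommGroup V] [Module k V] [DecidableEq I]
  {A : I → Submodule k V}

/-- The projection onto a component of an internal direct sum, as an endomorphism. -/
def internalProj (h : DirectSum.IsInternal A) (i : I) : V →ₗ[k] V :=
  (A i).subtype ∘ₗ DirectSum.component k I (fun j => A j) i ∘ₗ
    (LinearEquiv.ofBijective (DirectSum.coeLinearMap A) h).symm.toLinearMap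

theorem internalProj_of_mem (h : DirectSum.IsInternal A) {i j : I} {v : V} (hv : v ∈ A j) :
    internalProj h i v = if j = i then v else 0 := by
  have h1 : (LinearEquiv.ofBijective (DirectSum.coeLinearMap A) h).symm v =
      DirectSum.lof k I (fun j => A j) j ⟨v, hv⟩ := by
    rw [LinearEquiv.symm_apply_eq]
    exact (DirectSum.coeLinearMap_lof A j ⟨v, hv⟩).symm
  simp only [internalProj, LinearMap.comp_apply, LinearEquiv.coe_coe, h1, Submodule.subtype_apply]
  split_ifs with hij
  · subst hij
    rw [DirectSum.component.lof_self]
  · rw [DirectSum.component.of, dif_neg hij]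
    rfl

theorem internal_induction [Nonempty I] (h : DirectSum.IsInternal A) {P : V → Prop}
    (hmem : ∀ i, ∀ v ∈ A i, P v) (hadd : ∀ v w, P v → P w → P (v + w)) (v : V) : P v :=
  Submodule.iSup_induction A (motive := P) (by rw [h.submodule_iSup_eq_top]; trivial) hmem
    (hmem (Classical.arbitrary I) 0 (Submodule.zero_mem _)) hadd

end InternalProj

/-! ### Inclusions and homogeneous projections as morphisms of 𝒞 -/

section Sub

variable {k H V : Type*} [Field k] [Ring H] [HopfAlgebra k H] [AddCommGroup V] [Module k V]

theorem ActCoact.IsSub.isHom_subtype {X : ActCoact k H V} {N : Submodule k V} (h : X.IsSub N) :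
    IsHom (X.sub N h) X N.subtype where
  map_act := by
    ext a b
    simp [ActCoact.sub]
  map_coact := by
    ext v
    simp only [LinearMap.comp_apply, ActCoact.sub, LinearEquiv.coe_coe]
    rw [LinearEquiv.ofInjective_symm_apply (N.subtype.lTensor H)]
    rfl

variable {I : Type*} [DecidableEq I] [Nonempty I] {A : I → Submodule k V}

theorem isHom_internalProj {X : ActCoact k H V} (h : DirectSum.IsInternal A)
    (hA : ∀ i, X.IsSub (A i)) (i : I) : IsHom X X (internalProj h i) where
  map_act := by
    refine TensorProduct.ext' fun a v => ?_
    simp only [LinearMap.comp_apply, LinearMap.lTensor_tmul]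
    induction v using internal_induction h with
    | hmem j v hv =>
      rw [internalProj_of_mem h hv, internalProj_of_mem h ((hA j).act_mem a v hv)]
      split_ifs <;> simp
    | hadd v w hv hw => simp only [TensorProduct.tmul_add, map_add, hv, hw]
  map_coact := by
    ext v
    simp only [LinearMap.comp_apply]
    induction v using internal_induction h with
    | hmem j v hv =>
      obtain ⟨t, ht⟩ := (hA j).coact_mem v hv
      have h1 : internalProj h i ∘ₗ (A j).subtype = if j = i then (A j).subtype else 0 := by
        ext w
        simp only [LinearMap.comp_apply, Submodule.subtype_apply, internalProj_of_mem h w.2]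
        split_ifs <;> simp
      rw [← ht, ← LinearMap.lTensor_comp_apply, h1, internalProj_of_mem h hv]
      split_ifs with hij
      · rw [ht]
      · simp
    | hadd v w hv hw => simp only [map_add, hv, hw]

end Sub

/-! ### Degree arguments in a pre-Nichols system -/

section PreNichols

variable {k H Q : Type*} [Field k] [Ring H] [HopfAlgebra k H]
  [Ring Q] [Algebra k Q] [Coalgebra k Q] {θ : ℕ}

/-- A sum of two elements of ℕ₀^θ vanishes only if both do. -/
theorem PreNicholsSystem.proj_zero_mul (𝒩 : PreNicholsSystem k H Q θ) (a b : Q) :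
    internalProj 𝒩.isInternal 0 (a * b) =
      internalProj 𝒩.isInternal 0 a * internalProj 𝒩.isInternal 0 b := by
  induction a using internal_induction 𝒩.isInternal with
  | hadd a a' ha ha' => simp only [add_mul, map_add, ha, ha']
  | hmem m a ha =>
    induction b using internal_induction 𝒩.isInternal with
    | hadd b b' hb hb' => simp only [mul_add, map_add, hb, hb']
    | hmem n b hb =>
      rw [internalProj_of_mem _ ha, internalProj_of_mem _ hb,
        internalProj_of_mem _ (𝒩.mul_mem m n a ha b hb)]
      by_cases hm : m = 0 <;> by_cases hn : n = 0 <;> simp [hm, hn]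

/-- `Q` is connected: the projection onto degree 0 is multiplicative and kills the generators, so
its image is 𝕜 · 1. The counit then reads off the scalar. -/
theorem PreNicholsSystem.eq_counit_smul_one (𝒩 : PreNicholsSystem k H Q θ) {q : Q}
    (hq : q ∈ 𝒩.deg 0) : q = Coalgebra.counit (R := k) q • (1 : Q) := by
  have h1 : ∀ a : Q, ∃ c : k, internalProj 𝒩.isInternal 0 a = c • (1 : Q) := by
    intro a
    have ha : a ∈ Algebra.adjoin k (⋃ i, (𝒩.N i : Set Q)) := by
      rw [𝒩.adjoin_eq_top]; trivial
    induction ha using Algebra.adjoin_induction with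
    | mem x hx =>
      obtain ⟨i, hi⟩ := Set.mem_iUnion.mp hx
      have hi' : x ∈ 𝒩.deg (Pi.single i 1) := 𝒩.deg_single i ▸ hi
      exact ⟨0, by rw [internalProj_of_mem _ hi', if_neg (by simp), zero_smul]⟩
    | algebraMap r =>
      refine ⟨r, ?_⟩
      rw [Algebra.algebraMap_eq_smul_one, map_smul, internalProj_of_mem _ 𝒩.one_mem, if_pos rfl]
    | add x y _ _ hx hy =>
      obtain ⟨c, hc⟩ := hx
      obtain ⟨d, hd⟩ := hy
      exact ⟨c + d, by rw [map_add, hc, hd, add_smul]⟩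
    | mul x y _ _ hx hy =>
      obtain ⟨c, hc⟩ := hx
      obtain ⟨d, hd⟩ := hy
      exact ⟨c * d, by rw [𝒩.proj_zero_mul, hc, hd, smul_mul_smul_comm, one_mul]⟩
  obtain ⟨c, hc⟩ := h1 q
  rw [internalProj_of_mem _ hq, if_pos rfl] at hc
  rw [hc, map_smul, 𝒩.isBraidedHopf.counit_one, smul_eq_mul, mul_one]

theorem PreNicholsSystem.tmul_of_deg_zero (𝒩 : PreNicholsSystem k H Q θ) {W : Type*}
    [AddCommGroup W] [Module k W] {q : Q} (hq : q ∈ 𝒩.deg 0) (w : W) :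
    q ⊗ₜ[k] w = 1 ⊗ₜ[k] (Coalgebra.counit (R := k) q • w) := by
  conv_lhs => rw [𝒩.eq_counit_smul_one hq]
  rw [TensorProduct.smul_tmul]

/-- The degree α_i splits only as α_i + 0 or 0 + α_i, and degree 0 is 𝕜. Hence Δ(x) = y ⊗ 1 + 1 ⊗ z,
and the two counit axioms force y = z = x. -/
theorem PreNicholsSystem.comul_of_mem (𝒩 : PreNicholsSystem k H Q θ) (i : Fin θ) {x : Q}
    (hx : x ∈ 𝒩.N i) : Coalgebra.comul (R := k) x = x ⊗ₜ[k] 1 + 1 ⊗ₜ[k] x := by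
  have hsingle : ∀ m n : Fin θ → ℕ, m + n = Pi.single i 1 →
      (m = 0 ∧ n = Pi.single i 1) ∨ (m = Pi.single i 1 ∧ n = 0) := by
    intro m n h
    have hne : ∀ j, j ≠ i → m j = 0 ∧ n j = 0 := by
      intro j hj
      have := congrFun h j
      rw [Pi.add_apply, Pi.single_eq_of_ne hj] at this
      omega
    have hi := congrFun h i
    rw [Pi.add_apply, Pi.single_eq_same] at hi
    rcases Nat.eq_zero_or_pos (m i) with h0 | h0
    · left
      have : m = 0 := by
        ext j
        by_cases hj : j = i
        · rw [hj, h0]; rfl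
        · exact (hne j hj).1
      exact ⟨this, by simpa [this] using h⟩
    · right
      have : n = 0 := by
        ext j
        by_cases hj : j = i
        · rw [hj, Pi.zero_apply]; omega
        · exact (hne j hj).2
      exact ⟨by simpa [this] using h, this⟩
  have hx' : x ∈ 𝒩.deg (Pi.single i 1) := by rwa [𝒩.deg_single]
  have hzero : ∀ y ∈ 𝒩.N i, Coalgebra.counit (R := k) y = 0 := fun y hy =>
    𝒩.counit_eq_zero (Pi.single i 1) (by simp) y (by rwa [𝒩.deg_single])
  have hle : (⨆ (p : (Fin θ → ℕ) × (Fin θ → ℕ)) (_ : p.1 + p.2 = Pi.single i 1),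
      tensorSub (𝒩.deg p.1) (𝒩.deg p.2)) ≤
      (𝒩.N i).map ((TensorProduct.mk k Q Q).flip 1) ⊔ (𝒩.N i).map (TensorProduct.mk k Q Q 1) := by
    refine iSup₂_le ?_
    rintro ⟨m, n⟩ hmn _ ⟨t, rfl⟩
    rcases hsingle m n hmn with ⟨rfl, rfl⟩ | ⟨rfl, rfl⟩
    · refine Submodule.mem_sup_right ?_
      induction t using TensorProduct.induction_on with
      | zero => simp
      | add a b ha hb => rw [map_add]; exact Submodule.add_mem _ ha hb
      | tmul a b =>
        refine ⟨Coalgebra.counit (R := k) (a : Q) • b, ?_, ?_⟩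
        · exact Submodule.smul_mem _ _ (𝒩.deg_single i ▸ b.2)
        · exact (𝒩.tmul_of_deg_zero a.2 (b : Q)).symm
    · refine Submodule.mem_sup_left ?_
      induction t using TensorProduct.induction_on with
      | zero => simp
      | add a b ha hb => rw [map_add]; exact Submodule.add_mem _ ha hb
      | tmul a b =>
        refine ⟨Coalgebra.counit (R := k) (b : Q) • a, ?_, ?_⟩
        · exact Submodule.smul_mem _ _ (𝒩.deg_single i ▸ a.2)
        · rw [LinearMap.flip_apply, TensorProduct.mk_apply, TensorProduct.smul_tmul]
          exact congrArg ((a : Q) ⊗ₜ[k] ·) (𝒩.eq_counit_smul_one b.2).symm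
  obtain ⟨_, ⟨y, hy, rfl⟩, _, ⟨z, hz, rfl⟩, hyz⟩ :=
    Submodule.mem_sup.mp (hle (𝒩.comul_mem _ x hx'))
  simp only [LinearMap.flip_apply, TensorProduct.mk_apply] at hyz
  have h1 := congrArg (TensorProduct.lid k Q) (Coalgebra.rTensor_counit_comul (R := k) x)
  have h2 := congrArg (TensorProduct.rid k Q) (Coalgebra.lTensor_counit_comul (R := k) x)
  rw [← hyz] at h1 h2
  simp [hzero y hy, 𝒩.isBraidedHopf.counit_one] at h1
  simp [hzero z hz, 𝒩.isBraidedHopf.counit_one] at h2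
  rw [← hyz, h1, h2]

/-- Projecting onto m·α_i in all of `Q` avoids any choice of complement to 𝕜[N_i]; the recursion for
left multiplication by `N_i` is cancellation of α_i in ℕ₀^θ. -/
theorem PreNicholsSystem.isPrimitiveGrading (𝒩 : PreNicholsSystem k H Q θ) (i : Fin θ) :
    IsPrimitiveGrading 𝒩.obj (𝒩.N i)
      (fun m => internalProj 𝒩.isInternal (Pi.single i m)) where
  isSub := 𝒩.N_isSub i
  primitive _ hx := 𝒩.comul_of_mem i hx
  act m := (isHom_internalProj 𝒩.isInternal 𝒩.deg_isSub _).map_act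
  zero_apply q := by
    rw [Pi.single_zero]
    induction q using internal_induction 𝒩.isInternal with
    | hmem n q hq =>
      rw [internalProj_of_mem _ hq]
      split_ifs with h
      · subst h
        exact 𝒩.eq_counit_smul_one hq
      · rw [𝒩.counit_eq_zero n h q hq, zero_smul]
    | hadd a b ha hb => rw [map_add, ha, hb, map_add, add_smul]
  zero_mul x hx q := by
    rw [← 𝒩.deg_single] at hx
    induction q using internal_induction 𝒩.isInternal with
    | hmem n q hq =>
      rw [internalProj_of_mem _ (𝒩.mul_mem _ _ x hx q hq), if_neg]
      intro h
      have := congrFun h i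
      simp at this
    | hadd a b ha hb => rw [mul_add, map_add, ha, hb, add_zero]
  succ_mul x hx m q := by
    rw [← 𝒩.deg_single] at hx
    induction q using internal_induction 𝒩.isInternal with
    | hmem n q hq =>
      have h : Pi.single i 1 + n = Pi.single i (m + 1) ↔ n = Pi.single i m := by
        rw [add_comm m 1, Pi.single_add, add_right_inj]
      rw [internalProj_of_mem _ (𝒩.mul_mem _ _ x hx q hq), internalProj_of_mem _ hq]
      simp only [h, mul_ite, mul_zero]
    | hadd a b ha hb => rw [mul_add, map_add, ha, hb, map_add, mul_add]
  succ_one m := by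
    rw [internalProj_of_mem _ 𝒩.one_mem, if_neg]
    intro h
    have := congrFun h i
    simp at this

end PreNichols

/-! ### The recursion for (id ⊗ p)δ on powers of N -/

section Shapovalov

theorem rTensor_lTensor_comm {k A B A' B' : Type*} [Field k] [AddCommGroup A] [Module k A]
    [AddCommGroup B] [Module k B] [AddCommGroup A'] [Module k A'] [AddCommGroup B'] [Module k B']
    (f : A →ₗ[k] A') (g : B →ₗ[k] B') (t : A ⊗[k] B) :
    f.rTensor B' (g.lTensor A t) = g.lTensor A' (f.rTensor B t) := by
  simp only [LinearMap.rTensor, LinearMap.lTensor, TensorProduct.map_map, LinearMap.comp_id,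
    LinearMap.id_comp]

variable {k H Q : Type*} [Field k] [Ring H] [HopfAlgebra k H]
  [Ring Q] [Algebra k Q] {V : Type*} [AddCommGroup V] [Module k V]

/-- `(μ ⊗ id)(id ⊗ c_{V,Q}) : (Q ⊗ V) ⊗ Q → Q ⊗ V`. -/
def mulBraided (XQ : ActCoact k H Q) (XV : ActCoact k H V) :
    (Q ⊗[k] V) ⊗[k] Q →ₗ[k] Q ⊗[k] V :=
  (LinearMap.mul' k Q).rTensor V ∘ₗ (TensorProduct.assoc k Q Q V).symm.toLinearMap ∘ₗ
    (braiding XV XQ).lTensor Q ∘ₗ (TensorProduct.assoc k Q V Q).toLinearMap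

theorem mulBraided_tmul (XQ : ActCoact k H Q) (XV : ActCoact k H V) (a : Q) (v : V) (q : Q) :
    mulBraided XQ XV ((a ⊗ₜ v) ⊗ₜ q) =
      (LinearMap.mulLeft k a).rTensor V (braiding XV XQ (v ⊗ₜ q)) := by
  simp only [mulBraided, LinearMap.comp_apply, LinearEquiv.coe_coe, TensorProduct.assoc_tmul,
    LinearMap.lTensor_tmul]
  induction braiding XV XQ (v ⊗ₜ[k] q) using TensorProduct.induction_on with
  | zero => simp
  | add c d hc hd => simp only [TensorProduct.tmul_add, map_add, hc, hd]
  | tmul c d => simp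

theorem mulBraided_natural (XQ : ActCoact k H Q) {XV : ActCoact k H V} {p : V →ₗ[k] V}
    (hp : XV.coact ∘ₗ p = p.lTensor H ∘ₗ XV.coact) (s : (Q ⊗[k] V) ⊗[k] Q) :
    mulBraided XQ XV ((p.lTensor Q).rTensor Q s) = p.lTensor Q (mulBraided XQ XV s) := by
  refine LinearMap.congr_fun (f := mulBraided XQ XV ∘ₗ (p.lTensor Q).rTensor Q)
    (g := p.lTensor Q ∘ₗ mulBraided XQ XV) ?_ s
  ext a v q
  simp only [TensorProduct.AlgebraTensorModule.curry_apply, TensorProduct.curry_apply,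
    LinearMap.coe_restrictScalars, LinearMap.comp_apply, LinearMap.rTensor_tmul,
    LinearMap.lTensor_tmul, mulBraided_tmul, braiding_natural_left XQ hp,
    rTensor_lTensor_comm]

variable [Coalgebra k Q] {XQ : ActCoact k H Q} {S : Q →ₗ[k] Q} {XV : ActCoact k H V}
  {Y : ActCoact k Q V}

/-- The compatibility axiom with x ⊗ 1 + 1 ⊗ x substituted for the coproduct: each summand gives one
term on each side, the braidings with 1 being trivial. -/
theorem coact_act_of_primitive (hB : IsBraidedHopfAlgebra XQ S)
    (hY : IsYetterDrinfeldOver XQ XV Y) {x : Q}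
    (hx : Coalgebra.comul (R := k) x = x ⊗ₜ[k] 1 + 1 ⊗ₜ[k] x) (w : V) :
    Y.coact (Y.act (x ⊗ₜ w)) +
        mulBraided XQ XV (Y.coact.rTensor Q (braiding XQ XV (x ⊗ₜ w))) =
      (LinearMap.mulLeft k x).rTensor V (Y.coact w) +
        Y.act.lTensor Q (TensorProduct.assoc k Q Q V
          ((braiding XQ XQ ∘ₗ TensorProduct.mk k Q Q x).rTensor V (Y.coact w))) := by
  have h := LinearMap.congr_fun hY.compat (x ⊗ₜ w)
  simp only [LinearMap.comp_apply, LinearEquiv.coe_coe, TensorProduct.map_tmul, hx,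
    LinearMap.rTensor_tmul, TensorProduct.add_tmul, map_add, TensorProduct.assoc_tmul,
    LinearMap.lTensor_tmul,
    braiding_one_left hB hY.isYetterDrinfeld.toIsModComod, TensorProduct.assoc_symm_tmul] at h
  convert h.symm using 1
  · congr 1
    · induction Y.coact (Y.act (x ⊗ₜ[k] w)) using TensorProduct.induction_on with
      | zero => simp
      | add c d hc hd => simp only [TensorProduct.add_tmul, map_add, ← hc, ← hd]
      | tmul c d => simp [braiding_one_right hB hY.isYetterDrinfeld.toIsModComod]
    · induction braiding XQ XV (x ⊗ₜ[k] w) using TensorProduct.induction_on with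
      | zero => simp
      | add c d hc hd => simp only [TensorProduct.tmul_add, map_add, ← hc, ← hd]
      | tmul c d => simp [mulBraided, hY.isModComod.one_act]
  · congr 1
    · induction Y.coact w using TensorProduct.induction_on with
      | zero => simp
      | add c d hc hd => simp only [TensorProduct.tmul_add, map_add, ← hc, ← hd]
      | tmul c d =>
        simp [middle, braiding_one_left hB hB.isYetterDrinfeld.toIsModComod,
          hY.isModComod.one_act]
    · induction Y.coact w using TensorProduct.induction_on with
      | zero => simp
      | add c d hc hd => simp only [TensorProduct.tmul_add, map_add, ← hc, ← hd]
      | tmul c d =>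
        simp only [middle, LinearMap.comp_apply, LinearEquiv.coe_coe, TensorProduct.assoc_tmul,
          TensorProduct.assoc_symm_tmul, LinearMap.lTensor_tmul, LinearMap.rTensor_tmul,
          TensorProduct.mk_apply]
        induction braiding XQ XQ (x ⊗ₜ[k] c) using TensorProduct.induction_on with
        | zero => simp
        | add c d hc hd =>
          simp only [TensorProduct.tmul_add, TensorProduct.add_tmul, map_add, ← hc, ← hd]
        | tmul c d => simp

/-- The recursion for `(id ⊗ p) δ` along multiplication by primitive elements `x`, if `p` kills
`N · V`. -/
theorem projCoact_act (hB : IsBraidedHopfAlgebra XQ S) (hY : IsYetterDrinfeldOver XQ XV Y)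
    {N : Submodule k Q} (hN : XQ.IsSub N) {p : V →ₗ[k] V}
    (hp : XV.coact ∘ₗ p = p.lTensor H ∘ₗ XV.coact) (hpN : ∀ x ∈ N, ∀ w, p (Y.act (x ⊗ₜ w)) = 0)
    {x : Q} (hxN : x ∈ N) (hx : Coalgebra.comul (R := k) x = x ⊗ₜ[k] 1 + 1 ⊗ₜ[k] x) (w : V) :
    p.lTensor Q (Y.coact (Y.act (x ⊗ₜ w))) =
      (LinearMap.mulLeft k x).rTensor V (p.lTensor Q (Y.coact w)) -
        mulBraided XQ XV ((p.lTensor Q ∘ₗ Y.coact).rTensor Q (braiding XQ XV (x ⊗ₜ w))) := by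
  have h := congrArg (p.lTensor Q) (coact_act_of_primitive hB hY hx w)
  -- After x crosses the `Q`-leg of δ(w), what acts on the `V`-leg still lies in `N`, so `p`
  -- annihilates the result.
  have h0 : p.lTensor Q (Y.act.lTensor Q (TensorProduct.assoc k Q Q V
      ((braiding XQ XQ ∘ₗ TensorProduct.mk k Q Q x).rTensor V (Y.coact w)))) = 0 := by
    induction Y.coact w using TensorProduct.induction_on with
    | zero => simp
    | add c d hc hd => simp only [map_add, hc, hd, add_zero]
    | tmul a b =>
      rw [LinearMap.rTensor_tmul, LinearMap.comp_apply, TensorProduct.mk_apply]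
      obtain ⟨t, ht⟩ := exists_braiding_eq hN hxN a
      rw [← ht]
      clear ht
      induction t using TensorProduct.induction_on with
      | zero => simp
      | add c d hc hd => simp only [map_add, TensorProduct.add_tmul, hc, hd, add_zero]
      | tmul c d => simp [hpN]
  rw [map_add, map_add, h0, add_zero, ← mulBraided_natural XQ hp, ← LinearMap.rTensor_comp_apply]
    at h
  rw [eq_sub_iff_add_eq, h, rTensor_lTensor_comm]

/-- In the subtracted term of `projCoact_act`, x crosses y and then u; the coaction replaces y · u
by F(y) ⊗ u; finally x comes back across u. The two crossings of u give λ, and the crossing of y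
becomes twist_x(F(y)) since `F` is `H`-linear. -/
theorem projCoact_mul_act (hB : IsBraidedHopfAlgebra XQ S) (hY : IsYetterDrinfeldOver XQ XV Y)
    {N A : Submodule k Q} (hN : XQ.IsSub N) (hA : ∀ (h : H), ∀ a ∈ A, XQ.act (h ⊗ₜ a) ∈ A)
    {U : Submodule k V} (hU : XV.IsSub U) {p : V →ₗ[k] V}
    (hp : XV.coact ∘ₗ p = p.lTensor H ∘ₗ XV.coact) (hpN : ∀ x ∈ N, ∀ w, p (Y.act (x ⊗ₜ w)) = 0)
    {lam : k} (hlam : ∀ x ∈ N, ∀ u ∈ U,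
      braiding XV XQ (braiding XQ XV (x ⊗ₜ u)) = lam • (x ⊗ₜ[k] u))
    {F : Q →ₗ[k] Q} (hF : IsActLinear XQ XQ F)
    (hFA : ∀ y ∈ A, ∀ u ∈ U, p.lTensor Q (Y.coact (Y.act (y ⊗ₜ u))) = F y ⊗ₜ u)
    {x : Q} (hxN : x ∈ N) (hx : Coalgebra.comul (R := k) x = x ⊗ₜ[k] 1 + 1 ⊗ₜ[k] x)
    {y : Q} (hy : y ∈ A) {u : V} (hu : u ∈ U) :
    p.lTensor Q (Y.coact (Y.act ((x * y) ⊗ₜ u))) =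
      (x * F y - lam • twist XQ x (F y)) ⊗ₜ u := by
  rw [hY.isModComod.mul_act, projCoact_act hB hY hN hp hpN hxN hx, hFA y hy u hu,
    LinearMap.rTensor_tmul, LinearMap.mulLeft_apply, TensorProduct.sub_tmul]
  congr 1
  have h1 := braiding_natural_right XQ hY.act_hom.map_act x (y ⊗ₜ u)
  have h2 := LinearMap.congr_fun (braiding_tensor hB.isYetterDrinfeld.toIsModComod XQ XV)
    (x ⊗ₜ (y ⊗ₜ u))
  simp only [LinearMap.comp_apply, LinearEquiv.coe_coe, TensorProduct.assoc_symm_tmul,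
    LinearMap.rTensor_tmul] at h2
  rw [← LinearEquiv.eq_symm_apply] at h2
  rw [h1, h2, twist_map hF]
  obtain ⟨t, ht⟩ := braiding_mem hA hN.coact_mem hxN hy
  rw [← ht]
  clear ht h1 h2
  induction t using TensorProduct.induction_on with
  | zero => simp
  | add c d hc hd => simp only [map_add, TensorProduct.add_tmul, smul_add, hc, hd]
  | tmul a b =>
    obtain ⟨s, hs⟩ := braiding_mem hU.act_mem hN.coact_mem b.2 hu
    -- The braiding of b with u lands in U ⊗ N, so `hFA` applies in every summand and leaves the
    -- second braiding to act directly on the first.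
    have h3 : ∀ s : U ⊗[k] N, mulBraided XQ XV ((p.lTensor Q ∘ₗ Y.coact).rTensor Q (Y.act.rTensor Q
        ((TensorProduct.assoc k Q V Q).symm ((a : Q) ⊗ₜ
          (TensorProduct.map U.subtype N.subtype s))))) =
        (LinearMap.mulLeft k (F a)).rTensor V (braiding XV XQ
          (TensorProduct.map U.subtype N.subtype s)) := by
      intro s
      induction s using TensorProduct.induction_on with
      | zero => simp
      | add c d hc hd => simp only [map_add, TensorProduct.tmul_add, hc, hd]
      | tmul c d => simp [mulBraided_tmul, hFA]
    rw [TensorProduct.map_tmul, TensorProduct.assoc_tmul, LinearMap.lTensor_tmul]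
    simp only [Submodule.subtype_apply]
    rw [← hs, h3, hs, hlam b b.2 u hu]
    simp [TensorProduct.smul_tmul']

theorem act_mem_pow (hB : IsBraidedHopfAlgebra XQ S) {N : Submodule k Q} (hN : XQ.IsSub N)
    (n : ℕ) : ∀ (h : H), ∀ a ∈ N ^ n, XQ.act (h ⊗ₜ a) ∈ N ^ n := by
  induction n with
  | zero =>
    intro h a ha
    rw [pow_zero, Submodule.mem_one] at ha ⊢
    obtain ⟨c, rfl⟩ := ha
    refine ⟨c * Coalgebra.counit (R := k) h, ?_⟩
    rw [Algebra.algebraMap_eq_smul_one, Algebra.algebraMap_eq_smul_one, TensorProduct.tmul_smul,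
      map_smul, hB.act_one, smul_smul]
  | succ n ih =>
    intro h a ha
    rw [pow_succ'] at ha ⊢
    induction ha using Submodule.mul_induction_on' with
    | add a _ b _ ha hb => rw [TensorProduct.tmul_add, map_add]; exact Submodule.add_mem _ ha hb
    | mem_mul_mem x hx y hy =>
      have h1 := LinearMap.congr_fun (ActCoact.orbit_map hB.mul_hom.map_act (x ⊗ₜ y)) h
      rw [LinearMap.mul'_apply, ActCoact.orbit_apply] at h1
      rw [h1, LinearMap.comp_apply, ActCoact.orbit_tensor, LinearMap.comp_apply]
      induction Coalgebra.comul (R := k) h using TensorProduct.induction_on with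
      | zero => simp
      | add a b ha hb => rw [map_add, map_add]; exact Submodule.add_mem _ ha hb
      | tmul a b => exact Submodule.mul_mem_mul (hN.act_mem a x hx) (ih b y hy)

theorem projCoact_pow_act (hB : IsBraidedHopfAlgebra XQ S) (hY : IsYetterDrinfeldOver XQ XV Y)
    {N : Submodule k Q} {τ : ℕ → Q →ₗ[k] Q} (hN : IsPrimitiveGrading XQ N τ)
    {U : Submodule k V} (hU : XV.IsSub U) {p : V →ₗ[k] V}
    (hp : XV.coact ∘ₗ p = p.lTensor H ∘ₗ XV.coact) (hpN : ∀ x ∈ N, ∀ w, p (Y.act (x ⊗ₜ w)) = 0)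
    (hpU : ∀ u ∈ U, p.lTensor Q (Y.coact u) = 1 ⊗ₜ u)
    {lam : k} (hlam : ∀ x ∈ N, ∀ u ∈ U,
      braiding XV XQ (braiding XQ XV (x ⊗ₜ u)) = lam • (x ⊗ₜ[k] u))
    (n : ℕ) : ∀ y ∈ N ^ (n + 1), ∀ u ∈ U, p.lTensor Q (Y.coact (Y.act (y ⊗ₜ u))) =
      ((1 - lam) • ∑ m ∈ Finset.range (n + 1), (-lam) ^ m • shuffleEnd S τ m) y ⊗ₜ u := by
  induction n with
  | zero =>
    intro y hy u hu
    rw [zero_add, pow_one] at hy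
    -- The recursion is started at N^0 with F = id. The first step x · 1 produces x - λ twist_x(1) =
    -- (1 - λ)x, the source of the factor 1 - λ.
    have h1 := projCoact_mul_act hB hY hN.isSub (act_mem_pow hB hN.isSub 0) hU hp hpN hlam
      (F := LinearMap.id) (IsActLinear.id XQ) (by
        intro a ha u hu
        rw [pow_zero, Submodule.mem_one] at ha
        obtain ⟨c, rfl⟩ := ha
        rw [Algebra.algebraMap_eq_smul_one, ← TensorProduct.smul_tmul', map_smul, map_smul,
          map_smul, hY.isModComod.one_act, hpU u hu]
        simp [TensorProduct.smul_tmul']) hy (hN.primitive y hy)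
      (y := 1) (by rw [pow_zero]; exact Submodule.one_le.mp le_rfl) hu
    rw [mul_one] at h1
    rw [h1]
    simp [shuffleEnd_zero hB hN, twist_one hB, sub_smul]
  | succ n ih =>
    intro q hq u hu
    rw [pow_succ'] at hq
    induction hq using Submodule.mul_induction_on' with
    | add a _ b _ ha hb => simp only [TensorProduct.add_tmul, map_add, ha, hb]
    | mem_mul_mem x hx y hy =>
      rw [projCoact_mul_act hB hY hN.isSub (act_mem_pow hB hN.isSub (n + 1)) hU hp hpN hlam
        ((IsActLinear.sum _ fun m _ => (isActLinear_shuffleEnd hB hN m).smul _).smul _) ih hx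
        (hN.primitive x hx) hy hu]
      congr 1
      -- G_{n+1} vanishes on N^{n+1}, so a top term may be added and the index shifted to match the
      -- recursion of the G_m.
      have h1 : ∑ m ∈ Finset.range (n + 1), (-lam) ^ m • (x * shuffleEnd S τ m y) =
          ∑ m ∈ Finset.range (n + 1), (-lam) ^ (m + 1) • (x * shuffleEnd S τ (m + 1) y) +
            x * shuffleEnd S τ 0 y := by
        have h2 := Finset.sum_range_succ' (fun m => (-lam) ^ m • (x * shuffleEnd S τ m y)) (n + 1)
        rw [Finset.sum_range_succ, shuffleEnd_eq_zero hB hN n (n + 1) (by omega) y hy] at h2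
        simpa using h2
      simp only [LinearMap.smul_apply, LinearMap.sum_apply, map_smul, map_sum, mul_smul_comm,
        Finset.mul_sum, h1]
      rw [Finset.sum_range_succ' _ (n + 1)]
      simp only [shuffleEnd_succ_mul hB hN hx, smul_add, Finset.sum_add_distrib, Finset.smul_sum,
        shuffleEnd_zero hB hN, pow_zero, one_smul]
      have h3 : ∑ m ∈ Finset.range (n + 1),
          (1 - lam) • (-lam) ^ (m + 1) • twist XQ x (shuffleEnd S τ m y) =
          - ∑ m ∈ Finset.range (n + 1),
            lam • (1 - lam) • (-lam) ^ m • twist XQ x (shuffleEnd S τ m y) := by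
        rw [← Finset.sum_neg_distrib]
        refine Finset.sum_congr rfl fun m _ => ?_
        rw [pow_succ]
        module
      rw [h3]
      abel

end Shapovalov

/-! ### Degree arguments in V and the Shapovalov morphism -/

section GradedModule

variable {k H Q V Γ : Type*} [Field k] [Ring H] [HopfAlgebra k H] [Ring Q] [Algebra k Q]
  [Coalgebra k Q] {θ : ℕ} {𝒩 : PreNicholsSystem k H Q θ} [AddCommGroup Γ] [DecidableEq Γ]
  {ι : (Fin θ → ℤ) →+ Γ} [AddCommGroup V] [Module k V]

/-- Since V = Q · V(γ), the space N_i · V lives in degrees γ + ι(n) with n_i ≥ 1, and injectivity of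
`ι` keeps these away from γ. -/
theorem GradedYDModule.internalProj_act (hι : Function.Injective ι) (M : GradedYDModule 𝒩 ι V)
    {γ : Γ} (hγ : M.GeneratedBy γ) {i : Fin θ} {x : Q} (hx : x ∈ 𝒩.N i) (w : V) :
    internalProj M.isInternal γ (M.str.act (x ⊗ₜ w)) = 0 := by
  obtain ⟨t, rfl⟩ : w ∈ LinearMap.range (M.str.act ∘ₗ (M.deg γ).subtype.lTensor Q) := by
    rw [hγ]; trivial
  rw [← 𝒩.deg_single] at hx
  induction t using TensorProduct.induction_on with
  | zero => simp
  | add a b ha hb => rw [map_add, TensorProduct.tmul_add, map_add, map_add, ha, hb, add_zero]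
  | tmul q v =>
    rw [LinearMap.comp_apply, LinearMap.lTensor_tmul, Submodule.subtype_apply,
      ← M.isYetterDrinfeldOver.isModComod.mul_act]
    induction q using internal_induction 𝒩.isInternal with
    | hadd a b ha hb => rw [mul_add, TensorProduct.add_tmul, map_add, map_add, ha, hb, add_zero]
    | hmem n q hq =>
      rw [internalProj_of_mem _ (M.act_mem _ _ _ (𝒩.mul_mem _ _ x hx q hq) _ v.2), if_neg]
      intro h
      rw [add_eq_right, ← map_zero ι] at h
      have := congrFun (hι h) i
      simp only [Pi.add_apply, Pi.single_eq_same, Nat.cast_add, Nat.cast_one, Pi.zero_apply] at this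
      omega

/-- A summand of δ(v) with second degree γ has first degree 0, where `Q` is 𝕜; so the result is 1 ⊗
w, and the counit axiom gives w = v. -/
theorem GradedYDModule.internalProj_coact (hι : Function.Injective ι) (M : GradedYDModule 𝒩 ι V)
    {γ : Γ} {v : V} (hv : v ∈ M.deg γ) :
    (internalProj M.isInternal γ).lTensor Q (M.str.coact v) = 1 ⊗ₜ v := by
  have hle : (⨆ (p : (Fin θ → ℕ) × Γ) (_ : ι (fun j => (p.1 j : ℤ)) + p.2 = γ),
      tensorSub (𝒩.deg p.1) (M.deg p.2)) ≤
      (LinearMap.range (TensorProduct.mk k Q V 1)).comap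
        ((internalProj M.isInternal γ).lTensor Q) := by
    refine iSup₂_le ?_
    rintro ⟨n, γ'⟩ hn _ ⟨t, rfl⟩
    induction t using TensorProduct.induction_on with
    | zero => simp
    | add a b ha hb => rw [map_add]; exact Submodule.add_mem _ ha hb
    | tmul a b =>
      rw [Submodule.mem_comap, TensorProduct.map_tmul, LinearMap.lTensor_tmul,
        Submodule.subtype_apply, Submodule.subtype_apply, internalProj_of_mem _ b.2]
      by_cases h : γ' = γ
      · have h0 : n = 0 := by
          simp only [h, add_eq_right] at hn
          rw [← map_zero ι] at hn
          ext j
          simpa using congrFun (hι hn) j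
        subst h0
        exact ⟨_, (𝒩.tmul_of_deg_zero a.2 _).symm⟩
      · rw [if_neg h, TensorProduct.tmul_zero]
        exact Submodule.zero_mem _
  obtain ⟨w, hw⟩ := hle (M.coact_mem γ v hv)
  rw [TensorProduct.mk_apply] at hw
  have h1 := LinearMap.congr_fun M.isYetterDrinfeldOver.isModComod.counit_coact v
  have h2 := congrArg (internalProj M.isInternal γ) h1
  have h3 : ∀ t : Q ⊗[k] V, TensorProduct.lid k V ((Coalgebra.counit (R := k) (A := Q)).rTensor V
      ((internalProj M.isInternal γ).lTensor Q t)) = internalProj M.isInternal γ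
        (TensorProduct.lid k V ((Coalgebra.counit (R := k) (A := Q)).rTensor V t)) := by
    intro t
    induction t using TensorProduct.induction_on with
    | zero => simp
    | add a b ha hb => simp only [map_add, ha, hb]
    | tmul a b => simp
  simp only [LinearMap.comp_apply, LinearEquiv.coe_coe, LinearMap.id_apply] at h2
  rw [← h3, ← hw, internalProj_of_mem _ hv, if_pos rfl] at h2
  have h4 : w = v := by
    simpa [𝒩.isBraidedHopf.counit_one] using h2
  rw [← hw, h4]

/-- Naturality along the inclusions moves the hypothesis on N_i and V(γ) to the ambient objects. -/
theorem GradedYDModule.braiding_braiding (M : GradedYDModule 𝒩 ι V) {γ : Γ} {i : Fin θ} {lam : k}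
    (hbraid : braiding (M.degObj γ) (𝒩.NObj i) ∘ₗ braiding (𝒩.NObj i) (M.degObj γ) =
      lam • (LinearMap.id : 𝒩.N i ⊗[k] M.deg γ →ₗ[k] 𝒩.N i ⊗[k] M.deg γ))
    {x : Q} (hx : x ∈ 𝒩.N i) {v : V} (hv : v ∈ M.deg γ) :
    braiding M.obj 𝒩.obj (braiding 𝒩.obj M.obj (x ⊗ₜ v)) = lam • (x ⊗ₜ[k] v) := by
  have hN := (𝒩.N_isSub i).isHom_subtype
  have hV := (M.deg_isSub γ).isHom_subtype
  have h1 := LinearMap.congr_fun (braiding_natural hN.map_coact hV.map_act) (⟨x, hx⟩ ⊗ₜ ⟨v, hv⟩)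
  have h2 := LinearMap.congr_fun (braiding_natural hV.map_coact hN.map_act)
    (braiding (𝒩.NObj i) (M.degObj γ) (⟨x, hx⟩ ⊗ₜ ⟨v, hv⟩))
  have h3 := LinearMap.congr_fun hbraid (⟨x, hx⟩ ⊗ₜ ⟨v, hv⟩)
  simp only [LinearMap.comp_apply, TensorProduct.map_tmul, Submodule.subtype_apply] at h1 h2 h3
  rw [h1]
  refine h2.trans ((congrArg _ h3).trans ?_)
  simp

theorem GradedYDModule.shapovalov_act (hι : Function.Injective ι) (M : GradedYDModule 𝒩 ι V)
    {γ : Γ} (hγ : M.GeneratedBy γ) {i : Fin θ} {lam : k}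
    (hbraid : braiding (M.degObj γ) (𝒩.NObj i) ∘ₗ braiding (𝒩.NObj i) (M.degObj γ) =
      lam • (LinearMap.id : 𝒩.N i ⊗[k] M.deg γ →ₗ[k] 𝒩.N i ⊗[k] M.deg γ))
    (n : ℕ) {x : Q} (hx : x ∈ 𝒩.N i ^ (n + 1)) (v : M.deg γ) :
    M.shapovalov γ (M.str.act (x ⊗ₜ (v : V))) =
      (1 - lam) • ∑ m ∈ Finset.range (n + 1), (-lam) ^ m • (shuffleEnd 𝒩.antipode
        (fun m => internalProj 𝒩.isInternal (Pi.single i m)) m x ⊗ₜ[k] v) := by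
  -- The identity may be tested in Q ⊗ V, where the projection to V(γ) becomes the endomorphism p.
  apply Module.Flat.lTensor_preserves_injective_linearMap (M := Q) _ (M.deg γ).injective_subtype
  have h1 := projCoact_pow_act 𝒩.isBraidedHopf M.isYetterDrinfeldOver (𝒩.isPrimitiveGrading i)
    (M.deg_isSub γ) (isHom_internalProj M.isInternal M.deg_isSub γ).map_coact
    (fun x hx w => M.internalProj_act hι hγ hx w) (fun u hu => M.internalProj_coact hι hu)
    (fun x hx u hu => M.braiding_braiding hbraid hx hu) n x hx v v.2
  rw [GradedYDModule.shapovalov, LinearMap.comp_apply, ← LinearMap.lTensor_comp_apply]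
  refine h1.trans ?_
  simp only [LinearMap.smul_apply, LinearMap.sum_apply, ← TensorProduct.smul_tmul',
    TensorProduct.sum_tmul, map_smul, map_sum, LinearMap.lTensor_tmul, Submodule.subtype_apply]

end GradedModule

/-! ### The action of the braid group on tensor powers -/

section BraidAction

variable {k N : Type*} [Field k] [AddCommGroup N] [Module k N]

theorem tmul_tmul_ext {k A B C D : Type*} [Field k] [AddCommGroup A] [Module k A]
    [AddCommGroup B] [Module k B] [AddCommGroup C] [Module k C] [AddCommGroup D] [Module k D]
    {f g : A ⊗[k] (B ⊗[k] C) →ₗ[k] D}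
    (h : ∀ a b c, f (a ⊗ₜ (b ⊗ₜ c)) = g (a ⊗ₜ (b ⊗ₜ c))) : f = g := by
  refine TensorProduct.ext' fun a t => ?_
  induction t using TensorProduct.induction_on with
  | zero => simp
  | add x y hx hy => simp only [TensorProduct.tmul_add, map_add, hx, hy]
  | tmul b c => exact h a b c

theorem braidLeft_tmul (c : N ⊗[k] N →ₗ[k] N ⊗[k] N) {T : Type*} [AddCommGroup T] [Module k T]
    (x y : N) (s : T) : braidLeft c T (x ⊗ₜ (y ⊗ₜ s)) =
      TensorProduct.assoc k N N T (c (x ⊗ₜ y) ⊗ₜ s) := by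
  simp [braidLeft]

theorem braidAt_succ (c : N ⊗[k] N →ₗ[k] N ⊗[k] N) (n : ℕ) (j : Fin n)
    (t : N ⊗[k] ⨂[k]^(n + 1) N) :
    braidAt c (n + 1) j.succ (consEquiv k N (n + 1) t) =
      consEquiv k N (n + 1) ((braidAt c n j).lTensor N t) := by
  simp [braidAt]

variable (k N) in
/-- The canonical isomorphism `N ⊗ (N ⊗ N^{⊗n}) ≅ N^{⊗(n+2)}`. -/
def consEquiv₂ (n : ℕ) : N ⊗[k] (N ⊗[k] (⨂[k]^n N)) ≃ₗ[k] ⨂[k]^(n + 2) N :=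
  TensorProduct.congr (LinearEquiv.refl k N) (consEquiv k N n) ≪≫ₗ consEquiv k N (n + 1)

theorem consEquiv₂_apply (n : ℕ) (t : N ⊗[k] (N ⊗[k] (⨂[k]^n N))) :
    consEquiv₂ k N n t = consEquiv k N (n + 1) ((consEquiv k N n).toLinearMap.lTensor N t) := rfl

theorem braidAt_zero (c : N ⊗[k] N →ₗ[k] N ⊗[k] N) (n : ℕ) (t : N ⊗[k] (N ⊗[k] (⨂[k]^n N))) :
    braidAt c (n + 1) 0 (consEquiv₂ k N n t) = consEquiv₂ k N n (braidLeft c _ t) := by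
  simp only [braidAt, Fin.cases_zero, braidFirst, LinearMap.comp_apply, LinearEquiv.coe_coe]
  have h : ((TensorProduct.assoc k N N (⨂[k]^n N) ≪≫ₗ
      TensorProduct.congr (LinearEquiv.refl k N) (consEquiv k N n) ≪≫ₗ
        consEquiv k N (n + 1)).symm (consEquiv₂ k N n t)) =
      (TensorProduct.assoc k N N (⨂[k]^n N)).symm t := by
    rw [LinearEquiv.symm_apply_eq]
    simp [consEquiv₂]
  rw [h]
  rfl

theorem braidAt_succ_succ (c : N ⊗[k] N →ₗ[k] N ⊗[k] N) (n : ℕ) (j : Fin n)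
    (t : N ⊗[k] (N ⊗[k] ⨂[k]^(n + 1) N)) :
    braidAt c (n + 2) j.succ.succ (consEquiv₂ k N (n + 1) t) =
      consEquiv₂ k N (n + 1) (((braidAt c n j).lTensor N).lTensor N t) := by
  rw [consEquiv₂_apply, braidAt_succ, consEquiv₂_apply, ← LinearMap.lTensor_comp_apply,
    ← LinearMap.lTensor_comp_apply]
  exact congrArg _ (LinearMap.congr_fun (congrArg _ (LinearMap.ext (braidAt_succ c n j))) t)

theorem braidAt_succ_zero (c : N ⊗[k] N →ₗ[k] N ⊗[k] N) (n : ℕ)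
    (t : N ⊗[k] (N ⊗[k] (N ⊗[k] ⨂[k]^n N))) :
    braidAt c (n + 2) (Fin.succ 0)
        (consEquiv k N (n + 2) ((consEquiv₂ k N n).toLinearMap.lTensor N t)) =
      consEquiv k N (n + 2) ((consEquiv₂ k N n).toLinearMap.lTensor N
        ((braidLeft c _).lTensor N t)) := by
  rw [braidAt_succ, ← LinearMap.lTensor_comp_apply, ← LinearMap.lTensor_comp_apply]
  exact congrArg _ (LinearMap.congr_fun (congrArg _ (LinearMap.ext (braidAt_zero c n))) t)

theorem braidAt_id (n : ℕ) (j : Fin n) :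
    braidAt (LinearMap.id : N ⊗[k] N →ₗ[k] N ⊗[k] N) n j = 1 := by
  induction n with
  | zero => exact j.elim0
  | succ n ih =>
    refine LinearMap.ext fun t => ?_
    refine Fin.cases ?_ (fun j => ?_) j
    · obtain ⟨t, rfl⟩ := (consEquiv₂ k N n).surjective t
      rw [braidAt_zero]
      simp [braidLeft]
    · obtain ⟨t, rfl⟩ := (consEquiv k N (n + 1)).surjective t
      rw [braidAt_succ, ih]
      simp [Module.End.one_eq_id]

theorem braidAt_comp (c d : N ⊗[k] N →ₗ[k] N ⊗[k] N) (n : ℕ) (j : Fin n) :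
    braidAt (c ∘ₗ d) n j = braidAt c n j * braidAt d n j := by
  induction n with
  | zero => exact j.elim0
  | succ n ih =>
    refine LinearMap.ext fun t => ?_
    rw [Module.End.mul_apply]
    refine Fin.cases ?_ (fun j => ?_) j
    · obtain ⟨t, rfl⟩ := (consEquiv₂ k N n).surjective t
      simp only [braidAt_zero]
      simp [braidLeft, LinearMap.rTensor_comp_apply]
    · obtain ⟨t, rfl⟩ := (consEquiv k N (n + 1)).surjective t
      simp only [braidAt_succ, ih]
      rw [Module.End.mul_eq_comp, LinearMap.lTensor_comp_apply]

theorem braidAt_commute (c : N ⊗[k] N →ₗ[k] N ⊗[k] N) {n : ℕ} : ∀ {i j : Fin n},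
    (i : ℕ) + 2 ≤ j → braidAt c n i * braidAt c n j = braidAt c n j * braidAt c n i := by
  induction n with
  | zero => exact fun {i} => i.elim0
  | succ n ih =>
    intro i j hij
    refine LinearMap.ext fun t => ?_
    obtain ⟨j, rfl⟩ := Fin.exists_succ_eq.mpr (Fin.ne_zero_of_lt (Fin.lt_def.mpr
      (show (i : ℕ) < j by omega)))
    rw [Module.End.mul_apply, Module.End.mul_apply]
    rcases Fin.eq_zero_or_eq_succ i with rfl | ⟨i, rfl⟩
    · cases n with
      | zero => exact j.elim0
      | succ n =>
        obtain ⟨j, rfl⟩ := Fin.exists_succ_eq.mpr (show j ≠ 0 by rintro rfl; simp at hij)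
        obtain ⟨t, rfl⟩ := (consEquiv₂ k N (n + 1)).surjective t
        rw [braidAt_zero, braidAt_succ_succ, braidAt_succ_succ, braidAt_zero]
        congr 1
        refine LinearMap.congr_fun (f := braidLeft c _ ∘ₗ ((braidAt c n j).lTensor N).lTensor N)
          (g := ((braidAt c n j).lTensor N).lTensor N ∘ₗ braidLeft c _) ?_ t
        refine tmul_tmul_ext fun x y s => ?_
        simp only [LinearMap.comp_apply,
          LinearMap.lTensor_tmul, braidLeft_tmul]
        induction c (x ⊗ₜ[k] y) using TensorProduct.induction_on with
        | zero => simp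
        | add a b ha hb => simp only [TensorProduct.add_tmul, map_add, ha, hb]
        | tmul a b => simp
    · obtain ⟨t, rfl⟩ := (consEquiv k N (n + 1)).surjective t
      simp only [braidAt_succ, ← LinearMap.lTensor_comp_apply]
      rw [← Module.End.mul_eq_comp, ← Module.End.mul_eq_comp,
        ih (by simp only [Fin.val_succ] at hij; omega)]

/-- Rebracketing by `A` to (N ⊗ N ⊗ N) ⊗ T reduces this to the equation on three factors. -/
theorem braidLeft_yangBaxter {c : N ⊗[k] N →ₗ[k] N ⊗[k] N}
    (hc : braidLeft c N ∘ₗ c.lTensor N ∘ₗ braidLeft c N =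
      c.lTensor N ∘ₗ braidLeft c N ∘ₗ c.lTensor N) (T : Type*) [AddCommGroup T] [Module k T]
    (t : N ⊗[k] (N ⊗[k] (N ⊗[k] T))) :
    braidLeft c (N ⊗[k] T) ((braidLeft c T).lTensor N (braidLeft c (N ⊗[k] T) t)) =
      (braidLeft c T).lTensor N (braidLeft c (N ⊗[k] T) ((braidLeft c T).lTensor N t)) := by
  let A : (N ⊗[k] (N ⊗[k] N)) ⊗[k] T ≃ₗ[k] N ⊗[k] (N ⊗[k] (N ⊗[k] T)) :=
    TensorProduct.assoc k N (N ⊗[k] N) T ≪≫ₗ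
      TensorProduct.congr (LinearEquiv.refl k N) (TensorProduct.assoc k N N T)
  have h1 : ∀ u, braidLeft c (N ⊗[k] T) (A u) = A ((braidLeft c N).rTensor T u) := by
    intro u
    refine LinearMap.congr_fun (f := braidLeft c (N ⊗[k] T) ∘ₗ A.toLinearMap)
      (g := A.toLinearMap ∘ₗ (braidLeft c N).rTensor T) ?_ u
    ext x y z s
    simp only [TensorProduct.AlgebraTensorModule.curry_apply, TensorProduct.curry_apply,
      LinearMap.coe_restrictScalars, LinearMap.comp_apply, LinearEquiv.coe_coe,
      LinearMap.rTensor_tmul, braidLeft_tmul, A, LinearEquiv.trans_apply,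
      TensorProduct.assoc_tmul, TensorProduct.congr_tmul, LinearEquiv.refl_apply]
    induction c (x ⊗ₜ[k] y) using TensorProduct.induction_on with
    | zero => simp
    | add a b ha hb => simp only [TensorProduct.add_tmul, map_add, ha, hb]
    | tmul a b => simp
  have h2 : ∀ u, (braidLeft c T).lTensor N (A u) = A ((c.lTensor N).rTensor T u) := by
    intro u
    refine LinearMap.congr_fun (f := (braidLeft c T).lTensor N ∘ₗ A.toLinearMap)
      (g := A.toLinearMap ∘ₗ (c.lTensor N).rTensor T) ?_ u
    ext x y z s
    simp [A, braidLeft_tmul]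
  obtain ⟨u, rfl⟩ := A.surjective t
  simp only [h1, h2, ← LinearMap.rTensor_comp_apply]
  simp only [hc]

theorem braidAt_braid {c : N ⊗[k] N →ₗ[k] N ⊗[k] N}
    (hc : braidLeft c N ∘ₗ c.lTensor N ∘ₗ braidLeft c N =
      c.lTensor N ∘ₗ braidLeft c N ∘ₗ c.lTensor N) {n : ℕ} : ∀ {i j : Fin n},
    (i : ℕ) + 1 = j → braidAt c n i * braidAt c n j * braidAt c n i =
      braidAt c n j * braidAt c n i * braidAt c n j := by
  induction n with
  | zero => exact fun {i} => i.elim0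
  | succ n ih =>
    intro i j hij
    refine LinearMap.ext fun t => ?_
    obtain ⟨j, rfl⟩ := Fin.exists_succ_eq.mpr (Fin.ne_zero_of_lt (Fin.lt_def.mpr
      (show (i : ℕ) < j by omega)))
    simp only [Module.End.mul_apply]
    rcases Fin.eq_zero_or_eq_succ i with rfl | ⟨i, rfl⟩
    · cases n with
      | zero => exact j.elim0
      | succ n =>
        obtain rfl : j = 0 := by
          ext; simp only [Fin.val_succ, Fin.val_zero] at hij ⊢; omega
        -- By induction only the relation between the first two generators is left. It concerns the
        -- first three factors, so c_1 is rewritten with these split off.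
        have h0 : ∀ s, braidAt c (n + 2) 0 (consEquiv k N (n + 2)
            ((consEquiv₂ k N n).toLinearMap.lTensor N s)) =
            consEquiv k N (n + 2) ((consEquiv₂ k N n).toLinearMap.lTensor N
              (braidLeft c _ s)) := by
          intro s
          have e : ∀ s, consEquiv k N (n + 2) ((consEquiv₂ k N n).toLinearMap.lTensor N s) =
              consEquiv₂ k N (n + 1)
                (((consEquiv k N n).toLinearMap.lTensor N).lTensor N s) := by
            intro s
            rw [consEquiv₂_apply, ← LinearMap.lTensor_comp_apply]
            rfl
          rw [e, e, braidAt_zero]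
          congr 1
          refine LinearMap.congr_fun
            (f := braidLeft c _ ∘ₗ ((consEquiv k N n).toLinearMap.lTensor N).lTensor N)
            (g := ((consEquiv k N n).toLinearMap.lTensor N).lTensor N ∘ₗ braidLeft c _) ?_ s
          refine tmul_tmul_ext fun x y s => ?_
          simp only [LinearMap.comp_apply,
            LinearMap.lTensor_tmul, braidLeft_tmul]
          induction c (x ⊗ₜ[k] y) using TensorProduct.induction_on with
          | zero => simp
          | add a b ha hb => simp only [TensorProduct.add_tmul, map_add, ha, hb]
          | tmul a b => simp
        obtain ⟨t, rfl⟩ := (TensorProduct.congr (LinearEquiv.refl k N) (consEquiv₂ k N n) ≪≫ₗ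
          consEquiv k N (n + 2)).surjective t
        have e : (TensorProduct.congr (LinearEquiv.refl k N) (consEquiv₂ k N n) ≪≫ₗ
          consEquiv k N (n + 2)) t =
            consEquiv k N (n + 2) ((consEquiv₂ k N n).toLinearMap.lTensor N t) := rfl
        rw [e]
        simp only [h0, braidAt_succ_zero]
        rw [braidLeft_yangBaxter hc]
    · obtain ⟨t, rfl⟩ := (consEquiv k N (n + 1)).surjective t
      have := ih (i := i) (j := j) (by simp only [Fin.val_succ] at hij; omega)
      simp only [Module.End.mul_eq_comp] at this
      simp only [braidAt_succ, ← LinearMap.lTensor_comp_apply, ← LinearMap.comp_assoc, this]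

/-- `braidAt` for an invertible `c`, as a unit. -/
def braidUnit (c : N ⊗[k] N ≃ₗ[k] N ⊗[k] N) (n : ℕ) (j : Fin n) :
    (Module.End k (⨂[k]^(n + 1) N))ˣ where
  val := braidAt c.toLinearMap n j
  inv := braidAt c.symm.toLinearMap n j
  val_inv := by
    rw [← braidAt_comp, LinearEquiv.comp_coe, LinearEquiv.symm_trans_self]
    exact braidAt_id n j
  inv_val := by
    rw [← braidAt_comp, LinearEquiv.comp_coe, LinearEquiv.self_trans_symm]
    exact braidAt_id n j

variable {c : N ⊗[k] N ≃ₗ[k] N ⊗[k] N}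

/-- The action of the braid group on the tensor power of a braided vector space. -/
def braidRep (hc : braidLeft c.toLinearMap N ∘ₗ c.toLinearMap.lTensor N ∘ₗ
      braidLeft c.toLinearMap N =
    c.toLinearMap.lTensor N ∘ₗ braidLeft c.toLinearMap N ∘ₗ c.toLinearMap.lTensor N) (n : ℕ) :
    BraidGroup n →* (Module.End k (⨂[k]^(n + 1) N))ˣ :=
  PresentedGroup.toGroup (f := braidUnit c n) (by
    rintro r (⟨i, j, h, rfl⟩ | ⟨i, j, h, rfl⟩)
    · simp only [map_mul, map_inv, FreeGroup.lift_apply_of, mul_inv_eq_one]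
      exact Units.ext (braidAt_braid hc h)
    · simp only [map_mul, map_inv, FreeGroup.lift_apply_of, mul_inv_eq_one]
      exact Units.ext (braidAt_commute _ h))

variable (hc : braidLeft c.toLinearMap N ∘ₗ c.toLinearMap.lTensor N ∘ₗ
      braidLeft c.toLinearMap N =
    c.toLinearMap.lTensor N ∘ₗ braidLeft c.toLinearMap N ∘ₗ c.toLinearMap.lTensor N)

theorem braidRep_braidGen (n : ℕ) (j : Fin n) :
    ((braidRep hc n (braidGen n j) : (Module.End k (⨂[k]^(n + 1) N))ˣ) :
      Module.End k (⨂[k]^(n + 1) N)) = braidAt c.toLinearMap n j :=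
  congrArg Units.val (PresentedGroup.toGroup.of _)

/-- The action of the group algebra of the braid group. -/
def braidAlgRep (n : ℕ) : MonoidAlgebra k (BraidGroup n) →ₐ[k] Module.End k (⨂[k]^(n + 1) N) :=
  MonoidAlgebra.lift k _ (BraidGroup n) ((Units.coeHom _).comp (braidRep hc n))

theorem braidAlgRep_of (n : ℕ) (b : BraidGroup n) :
    braidAlgRep hc n (MonoidAlgebra.of k _ b) = (braidRep hc n b).val := by
  simp [braidAlgRep]

theorem braidRep_shiftBraid (n : ℕ) (b : BraidGroup n) (t : N ⊗[k] ⨂[k]^(n + 1) N) :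
    (braidRep hc (n + 1) (shiftBraid n b)).val (consEquiv k N (n + 1) t) =
      consEquiv k N (n + 1) ((braidRep hc n b).val.lTensor N t) := by
  have hb : b ∈ Subgroup.closure (Set.range (PresentedGroup.of (rels := braidRels n))) := by
    rw [PresentedGroup.closure_range_of]; trivial
  induction hb using Subgroup.closure_induction generalizing t with
  | mem x hx =>
    obtain ⟨j, rfl⟩ := hx
    have h1 := shiftBraid_braidGen j
    have h2 := braidRep_braidGen hc n j
    rw [braidGen] at h1 h2
    rw [h1, h2, braidRep_braidGen, braidAt_succ]
  | one => simp [Module.End.one_eq_id]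
  | mul x y _ _ hx hy =>
    simp only [map_mul, Units.val_mul, Module.End.mul_apply, hy, hx]
    rw [Module.End.mul_eq_comp, LinearMap.lTensor_comp_apply]
  | inv x _ hx =>
    -- The claim for x⁻¹ results from the claim for x at the tensor already moved by x⁻¹.
    have h := hx ((braidRep hc n x⁻¹).val.lTensor N t)
    rw [← LinearMap.lTensor_comp_apply, ← Module.End.mul_eq_comp, ← Units.val_mul, ← map_mul,
      mul_inv_cancel, map_one, Units.val_one, Module.End.one_eq_id, LinearMap.lTensor_id,
      LinearMap.id_apply] at h
    rw [← h, ← Module.End.mul_apply, ← Units.val_mul, ← map_mul, ← map_mul, inv_mul_cancel,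
      map_one, map_one, Units.val_one, Module.End.one_apply]

theorem braidAlgRep_shiftAlg (n : ℕ) (a : MonoidAlgebra k (BraidGroup n))
    (t : N ⊗[k] ⨂[k]^(n + 1) N) :
    braidAlgRep hc (n + 1) (shiftAlg k n a) (consEquiv k N (n + 1) t) =
      consEquiv k N (n + 1) ((braidAlgRep hc n a).lTensor N t) := by
  induction a using MonoidAlgebra.induction_on with
  | of b => rw [shiftAlg_of, braidAlgRep_of, braidAlgRep_of, braidRep_shiftBraid]
  | add a b ha hb =>
    simp only [map_add, LinearMap.add_apply, ha, hb, LinearMap.lTensor_add]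
  | smul r a ha => simp only [map_smul, LinearMap.smul_apply, ha, LinearMap.lTensor_smul]

end BraidAction

/-! ### Multiplication from tensor powers to powers of N -/

section MulTensor

variable {k Q : Type*} [Field k] [Ring Q] [Algebra k Q] (N : Submodule k Q)

theorem mulTensor_tprod (n : ℕ) (f : Fin n → N) :
    mulTensor N n (PiTensorProduct.tprod k f) = (List.ofFn fun j => (f j : Q)).prod := by
  simp [mulTensor, PiTensorProduct.lift.tprod]

theorem mulTensor_consEquiv (n : ℕ) (x : N) (s : ⨂[k]^n N) :
    mulTensor N (n + 1) (consEquiv k N n (x ⊗ₜ s)) = x * mulTensor N n s := by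
  induction s using PiTensorProduct.induction_on with
  | smul_tprod r f =>
    rw [TensorProduct.tmul_smul, map_smul, map_smul, map_smul, consEquiv_tmul_tprod,
      mulTensor_tprod, mulTensor_tprod, List.ofFn_succ, List.prod_cons, mul_smul_comm]
    simp
  | add a b ha hb => simp only [TensorProduct.tmul_add, map_add, ha, hb, mul_add]

theorem exists_mulTensor_eq (n : ℕ) : ∀ q ∈ N ^ n, ∃ t, mulTensor N n t = q := by
  induction n with
  | zero =>
    intro q hq
    rw [pow_zero, Submodule.mem_one] at hq
    obtain ⟨r, rfl⟩ := hq
    refine ⟨r • PiTensorProduct.tprod k Fin.elim0, ?_⟩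
    rw [map_smul, mulTensor_tprod, Algebra.algebraMap_eq_smul_one]
    simp
  | succ n ih =>
    intro q hq
    rw [pow_succ'] at hq
    induction hq using Submodule.mul_induction_on' with
    | add a _ b _ ha hb =>
      obtain ⟨s, rfl⟩ := ha
      obtain ⟨t, rfl⟩ := hb
      exact ⟨s + t, map_add _ _ _⟩
    | mem_mul_mem x hx y hy =>
      obtain ⟨s, rfl⟩ := ih y hy
      exact ⟨consEquiv k N n (⟨x, hx⟩ ⊗ₜ s), mulTensor_consEquiv N n ⟨x, hx⟩ s⟩

end MulTensor

/-! ### The braiding on N and the operators induced by the shuffle elements -/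

section Restriction

variable {k H Q : Type*} [Field k] [Ring H] [HopfAlgebra k H] [Ring Q] [Algebra k Q]
  {X : ActCoact k H Q} {N : Submodule k Q}

theorem braiding_sub (hN : X.IsSub N) (t : N ⊗[k] N) :
    TensorProduct.map N.subtype N.subtype (braiding (X.sub N hN) (X.sub N hN) t) =
      braiding X X (TensorProduct.map N.subtype N.subtype t) :=
  (LinearMap.congr_fun (braiding_natural hN.isHom_subtype.map_coact hN.isHom_subtype.map_act)
    t).symm

/-- The equation descends from `Q` along the injection of N ⊗ N ⊗ N into Q ⊗ Q ⊗ Q, without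
verifying the Yetter-Drinfeld axioms on `N`. -/
theorem yangBaxter_sub (hX : X.IsYetterDrinfeld) (hN : X.IsSub N) :
    braidLeft (braiding (X.sub N hN) (X.sub N hN)) N ∘ₗ
      (braiding (X.sub N hN) (X.sub N hN)).lTensor N ∘ₗ
        braidLeft (braiding (X.sub N hN) (X.sub N hN)) N =
    (braiding (X.sub N hN) (X.sub N hN)).lTensor N ∘ₗ
      braidLeft (braiding (X.sub N hN) (X.sub N hN)) N ∘ₗ
        (braiding (X.sub N hN) (X.sub N hN)).lTensor N := by
  let J : N ⊗[k] (N ⊗[k] N) →ₗ[k] Q ⊗[k] (Q ⊗[k] Q) :=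
    TensorProduct.map N.subtype (TensorProduct.map N.subtype N.subtype)
  have hJ : Function.Injective J :=
    TensorProduct.map_injective_of_flat_flat _ _ N.injective_subtype
      (TensorProduct.map_injective_of_flat_flat _ _ N.injective_subtype N.injective_subtype)
  have h1 : ∀ t, J ((braiding (X.sub N hN) (X.sub N hN)).lTensor N t) =
      (braiding X X).lTensor Q (J t) := by
    intro t
    induction t using TensorProduct.induction_on with
    | zero => simp
    | add a b ha hb => simp only [map_add, ha, hb]
    | tmul a b => simp [J, braiding_sub]
  have h2 : ∀ t, J (braidLeft (braiding (X.sub N hN) (X.sub N hN)) N t) =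
      braidLeft (braiding X X) Q (J t) := by
    intro t
    refine LinearMap.congr_fun (f := J ∘ₗ braidLeft (braiding (X.sub N hN) (X.sub N hN)) N)
      (g := braidLeft (braiding X X) Q ∘ₗ J) ?_ t
    refine tmul_tmul_ext fun x y s => ?_
    have h3 := braiding_sub hN (x ⊗ₜ y)
    simp only [TensorProduct.map_tmul] at h3
    simp only [LinearMap.comp_apply,
      braidLeft_tmul, J, TensorProduct.map_tmul, ← h3]
    induction braiding (X.sub N hN) (X.sub N hN) (x ⊗ₜ[k] y) using
      TensorProduct.induction_on with
    | zero => simp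
    | add a b ha hb => simp only [TensorProduct.add_tmul, map_add, ha, hb]
    | tmul a b => simp
  refine LinearMap.ext fun t => hJ ?_
  have h := LinearMap.congr_fun (yangBaxter hX) (J t)
  simpa only [LinearMap.comp_apply, h1, h2] using h

theorem braiding_sub_injective
    (hH : Function.Bijective (HopfAlgebra.antipode k : H →ₗ[k] H)) (hX : X.IsModComod)
    (hN : X.IsSub N) : Function.Injective (braiding (X.sub N hN) (X.sub N hN)) := by
  have hJ : Function.Injective (TensorProduct.map N.subtype N.subtype) :=
    TensorProduct.map_injective_of_flat_flat _ _ N.injective_subtype N.injective_subtype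
  intro s t hst
  apply hJ
  apply braiding_injective hH hX hX
  rw [← braiding_sub hN, ← braiding_sub hN, hst]

variable [Coalgebra k Q] {S : Q →ₗ[k] Q}

variable {c : N ⊗[k] N ≃ₗ[k] N ⊗[k] N}
  (hc : braidLeft c.toLinearMap N ∘ₗ c.toLinearMap.lTensor N ∘ₗ braidLeft c.toLinearMap N =
    c.toLinearMap.lTensor N ∘ₗ braidLeft c.toLinearMap N ∘ₗ c.toLinearMap.lTensor N)

/-- In c_n⋯c_1 the generator c_1 acts first, so x is carried to the right past one factor after
another; multiplying out, this is the iteration of `twist_mul`. -/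
theorem mulTensor_cycleBraid (hB : IsBraidedHopfAlgebra X S)
    (hcX : ∀ t, TensorProduct.map N.subtype N.subtype (c t) =
      braiding X X (TensorProduct.map N.subtype N.subtype t)) (n : ℕ) :
    ∀ (x : N) (s : ⨂[k]^n N),
      mulTensor N (n + 1) ((braidRep hc n (cycleBraid n)).val (consEquiv k N n (x ⊗ₜ s))) =
        twist X x (mulTensor N n s) := by
  induction n with
  | zero =>
    intro x s
    have h1 : cycleBraid 0 = 1 := rfl
    rw [h1, map_one, Units.val_one, Module.End.one_apply, mulTensor_consEquiv]
    induction s using PiTensorProduct.induction_on with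
    | smul_tprod r f => simp [mulTensor_tprod, twist_one hB]
    | add a b ha hb => simp only [map_add, mul_add, ha, hb]
  | succ n ih =>
    intro x s
    obtain ⟨s, rfl⟩ := (consEquiv k N n).surjective s
    induction s using TensorProduct.induction_on with
    | zero => simp
    | add a b ha hb => simp only [TensorProduct.tmul_add, map_add, ha, hb]
    | tmul y s =>
      rw [cycleBraid_succ, map_mul, Units.val_mul, Module.End.mul_apply, braidRep_braidGen]
      have h1 := braidAt_zero c.toLinearMap n (x ⊗ₜ (y ⊗ₜ s))
      rw [consEquiv₂_apply, LinearMap.lTensor_tmul, LinearEquiv.coe_coe, braidLeft_tmul,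
        LinearEquiv.coe_coe, consEquiv₂_apply] at h1
      rw [h1, braidRep_shiftBraid, mulTensor_consEquiv, twist_mul hB]
      have h2 := hcX (x ⊗ₜ y)
      rw [TensorProduct.map_tmul] at h2
      simp only [Submodule.subtype_apply] at h2
      rw [← h2]
      induction c (x ⊗ₜ[k] y) using TensorProduct.induction_on with
      | zero => simp
      | add a b ha hb => simp only [TensorProduct.add_tmul, map_add, ha, hb]
      | tmul a b =>
        rw [TensorProduct.assoc_tmul, LinearMap.lTensor_tmul, LinearMap.lTensor_tmul,
          mulTensor_consEquiv, LinearEquiv.coe_coe, ih]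
        simp

/-- Both sides obey the same recursion in n with the same initial values. The right side depends
only on the product of `t`, which is what makes the induced endomorphisms well defined. -/
theorem mulTensor_gElem (hB : IsBraidedHopfAlgebra X S) {τ : ℕ → Q →ₗ[k] Q}
    (hN : IsPrimitiveGrading X N τ)
    (hcX : ∀ t, TensorProduct.map N.subtype N.subtype (c t) =
      braiding X X (TensorProduct.map N.subtype N.subtype t)) (n : ℕ) :
    ∀ (m : ℕ) (t : ⨂[k]^(n + 1) N), mulTensor N (n + 1) (braidAlgRep hc n (gElem k n m) t) =
      shuffleEnd S τ m (mulTensor N (n + 1) t) := by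
  induction n with
  | zero =>
    intro m t
    rcases m with _ | m
    · rw [gElem_zero_zero, map_one, Module.End.one_apply, shuffleEnd_zero hB hN]
    · rw [gElem_eq_zero k (Nat.succ_pos m), map_zero, LinearMap.zero_apply, map_zero,
        shuffleEnd_eq_zero hB hN 0 _ (Nat.succ_pos m) _ (mulTensor_mem N 1 t)]
  | succ n ih =>
    intro m t
    obtain ⟨t, rfl⟩ := (consEquiv k N (n + 1)).surjective t
    induction t using TensorProduct.induction_on with
    | zero => simp
    | add a b ha hb => simp only [map_add, ha, hb]
    | tmul x s =>
      rcases m with _ | m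
      · rw [gElem_succ_zero, braidAlgRep_shiftAlg, LinearMap.lTensor_tmul, mulTensor_consEquiv,
          mulTensor_consEquiv, ih, shuffleEnd_zero hB hN, shuffleEnd_zero hB hN]
      · rw [gElem_succ_succ, map_add, map_mul, LinearMap.add_apply, Module.End.mul_apply,
          braidAlgRep_shiftAlg, braidAlgRep_shiftAlg, LinearMap.lTensor_tmul,
          LinearMap.lTensor_tmul, map_add, mulTensor_consEquiv, mulTensor_consEquiv, ih,
          braidAlgRep_of, mulTensor_cycleBraid hc hB hcX, ih, shuffleEnd_succ_mul hB hN x.2]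

end Restriction

end YDNichols

end

/-! ### The theorem -/

theorem mainTheorem4 {k H Q V Γ : Type*} [Field k]
    [Ring H] [HopfAlgebra k H]
    (hH : Function.Bijective (HopfAlgebra.antipode k : H →ₗ[k] H))
    [Ring Q] [Algebra k Q] [Coalgebra k Q] {θ : ℕ} (𝒩 : PreNicholsSystem k H Q θ)
    [AddCommGroup Γ] [DecidableEq Γ] (ι : (Fin θ → ℤ) →+ Γ) (hι : Function.Injective ι)
    [AddCommGroup V] [Module k V] (M : GradedYDModule 𝒩 ι V)
    (γ : Γ) (hγ : M.GeneratedBy γ)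
    (i : Fin θ) (hi : 𝒩.StrictlyGraded i)
    (lam : k) (hlam : lam ≠ 0)
    (hbraid : braiding (M.degObj γ) (𝒩.NObj i) ∘ₗ braiding (𝒩.NObj i) (M.degObj γ) =
      lam • (LinearMap.id : 𝒩.N i ⊗[k] M.deg γ →ₗ[k] 𝒩.N i ⊗[k] M.deg γ))
    (n : ℕ) :
    -- the action of the group algebra of the braid group on the tensor power
    ∃ ρ : MonoidAlgebra k (BraidGroup n) →ₐ[k] Module.End k (⨂[k]^(n + 1) (𝒩.N i)),
      (∀ j : Fin n, ρ (MonoidAlgebra.of k (BraidGroup n) (braidGen n j)) =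
        braidAt (braiding (𝒩.NObj i) (𝒩.NObj i)) n j) ∧
      -- the endomorphisms induced by the shuffle elements on the powers of the component
      ∃ g : ℕ → Module.End k ↥(𝒩.N i ^ (n + 1)),
        (∀ (m : ℕ) (t : ⨂[k]^(n + 1) (𝒩.N i)),
          g m (mulPow (𝒩.N i) (n + 1) t) = mulPow (𝒩.N i) (n + 1) (ρ (gElem k n m) t)) ∧
        ∀ (x : ↥(𝒩.N i ^ (n + 1))) (v : M.deg γ),
          M.shapovalov γ (M.str.act ((x : Q) ⊗ₜ[k] (v : V))) =
            (1 - lam) • ∑ m ∈ Finset.range (n + 1),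
              (-lam) ^ m • ((g m x : Q) ⊗ₜ[k] v) := by
  have := 𝒩.finite i
  have hB := 𝒩.isBraidedHopf
  have hN := 𝒩.isPrimitiveGrading i
  have hinj := braiding_sub_injective hH hB.isYetterDrinfeld.toIsModComod (𝒩.N_isSub i)
  -- N_i is finite-dimensional, so an injective braiding is invertible and the group, not only the
  -- monoid, acts.
  have hsurj := LinearMap.surjective_of_injective (K := k) (V := 𝒩.N i ⊗[k] 𝒩.N i)
    (f := braiding (𝒩.NObj i) (𝒩.NObj i)) hinj
  let c : 𝒩.N i ⊗[k] 𝒩.N i ≃ₗ[k] 𝒩.N i ⊗[k] 𝒩.N i :=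
    LinearEquiv.ofBijective (braiding (𝒩.NObj i) (𝒩.NObj i)) ⟨hinj, hsurj⟩
  have hcoe : c.toLinearMap = braiding (𝒩.NObj i) (𝒩.NObj i) := LinearMap.ext fun _ => rfl
  have hc : braidLeft c.toLinearMap (𝒩.N i) ∘ₗ c.toLinearMap.lTensor (𝒩.N i) ∘ₗ
      braidLeft c.toLinearMap (𝒩.N i) = c.toLinearMap.lTensor (𝒩.N i) ∘ₗ
      braidLeft c.toLinearMap (𝒩.N i) ∘ₗ c.toLinearMap.lTensor (𝒩.N i) := by
    rw [hcoe]
    exact yangBaxter_sub hB.isYetterDrinfeld (𝒩.N_isSub i)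
  have hg := mulTensor_gElem hc hB hN (braiding_sub (𝒩.N_isSub i)) n
  -- Stability of the power under G_m is read off from `hg`: every element is the product of some
  -- tensor, and the braid action stays inside the tensor power.
  have hmem : ∀ m, ∀ q ∈ 𝒩.N i ^ (n + 1), shuffleEnd 𝒩.antipode
      (fun m => internalProj 𝒩.isInternal (Pi.single i m)) m q ∈ 𝒩.N i ^ (n + 1) := by
    intro m q hq
    obtain ⟨t, rfl⟩ := exists_mulTensor_eq (𝒩.N i) (n + 1) q hq
    rw [← hg]
    exact mulTensor_mem _ _ _
  refine ⟨braidAlgRep hc n, fun j => ?_, fun m => (shuffleEnd 𝒩.antipode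
    (fun m => internalProj 𝒩.isInternal (Pi.single i m)) m).restrict (hmem m),
    fun m t => Subtype.ext (hg m t).symm, fun x v => ?_⟩
  · rw [braidAlgRep_of, braidRep_braidGen, hcoe]
  · exact M.shapovalov_act hι hγ hbraid n x.2 v
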